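/- Let $\lambda,\mu,\nu>0$. Updates are generated at the epochs of a Poisson process of rate $\lambda$ on $[0,\infty)$ and offered to a single server that is idle at time $0$ and has no buffer: an update that arrives while the server is busy is discarded; one that arrives while it is idle is called successful and enters service at once. The service times of the successful updates are i.i.d. copies of a random variable $S\ge 0$ with $\mathbb E[S]=1/\mu$ and $\mathbb E[S^2]<\infty$. Decisions are made at the epochs $\tau_1<\tau_2<\cdots$ of a Poisson process of rate $\nu$ on $[0,\infty)$. The arrival process, the service times and the decision process are independent (the M/G/1/1-M bufferless system). Let $t_k$ and $t_k'$ be the arrival time and the service completion time of the $k$-th successful update. The age upon decisions at a decision epoch $\tau_j$ is $\Delta_{\rm D}(\tau_j)=\tau_j-t_{N(\tau_j)}$ with $N(\tau_j)=\max\{k: t_k'\le\tau_j\}$; before the first completion, $t_{N(\tau_j)}$ is replaced by an arbitrary finite initial value $u_0$ (possibly random). Let $N_T$ be the number of decisions made up to time $T$. Then, almost surely, $\tau_j\to\infty$ as $j\to\infty$ and the average age upon decisions exists and equals \[ \overline{\Delta}_{\rm D}=\lim_{T\to\infty}\frac1{N_T}\sum_{j=1}^{N_T}\Delta_{\rm D}(\tau_j)=\frac{\lambda\mu\,\mathbb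 E[S^2]}{2(\lambda+\mu)}+\frac{\lambda+\mu}{\lambda\mu}. \] In particular, it does not depend on $\nu$, nor on $u_0$. -/

import Mathlib

open MeasureTheory ProbabilityTheory Filter Topology

noncomputable section

namespace UpdateDecision

/-- Epoch of the `n`-th event (`n = 0, 1, …`) of the point process on the half line whose
inter-event times are `x 0, x 1, …`: the event `n` occurs at `x 0 + ⋯ + x n`. -/
def epoch (x : ℕ → ℝ) (n : ℕ) : ℝ := ∑ i ∈ Finset.range (n + 1), x i

/-- The number, among all generated updates, of the `k`-th successful update, in a bufferless
blocking queue that is idle at time `0`: `a n` is the arrival time of update `n` and `s k` is the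
service time of the `k`-th successful update. The first update finds the server idle. The next
successful update is the first later update that arrives when the service of the current one is
over; those that arrive before are discarded. -/
def successfulIndex (a s : ℕ → ℝ) : ℕ → ℕ
  | 0 => 0
  | k + 1 =>
      sInf {n | successfulIndex a s k < n ∧ a (successfulIndex a s k) + s k ≤ a n}

/-- Arrival (generation) time `t_k` of the `k`-th successful update. -/
def arrivalTime (a s : ℕ → ℝ) (k : ℕ) : ℝ := a (successfulIndex a s k)

/-- Time `t_k'` at which the service of the `k`-th successful update is completed. -/
def departureTime (a s : ℕ → ℝ) (k : ℕ) : ℝ := arrivalTime a s k + s k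

open Classical in
/-- Generation time `U(t)` of the update most recently received at time `t`, that is, of the
update number `N(t) = max {k | t_k' ≤ t}`. As long as nothing has been received, it is the
generation time `u₀` of the information that was available initially. -/
def generationTime (u₀ : ℝ) (a s : ℕ → ℝ) (t : ℝ) : ℝ :=
  if ∃ k, departureTime a s k ≤ t then arrivalTime a s (sSup {k | departureTime a s k ≤ t})
  else u₀

/-- Age upon decisions: the age, at a decision epoch `t`, of the update most recently received. -/
def ageUponDecision (u₀ : ℝ) (a s : ℕ → ℝ) (t : ℝ) : ℝ := t - generationTime u₀ a s t

/-- Number `N_T` of the decisions made up to time `T`, where `τ j` is the epoch of decision `j`. -/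
def decisionCount (τ : ℕ → ℝ) (T : ℝ) : ℕ := Set.ncard {j | τ j ≤ T}

/-- The decision epochs `τ` tend to infinity and the average of the ages upon decisions `Δ (τ j)`
over the decisions made up to time `T` tends to `v` as `T → ∞`. -/
def HasAverageAge (τ : ℕ → ℝ) (Δ : ℝ → ℝ) (v : ℝ) : Prop :=
  Tendsto τ atTop atTop ∧
    Tendsto (fun T : ℝ => (∑ j ∈ Finset.range (decisionCount τ T), Δ (τ j)) / decisionCount τ T)
      atTop (𝓝 v)

/-- The random data of the M/G/1/1-M bufferless system on a probability space: the inter-arrival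
times `X n` of all generated updates are exponential with rate `lam`, the service times `S k` of
the successful updates have the law `G`, the inter-decision times `Z j` are exponential with
rate `nu`, and all of these random variables are mutually independent. -/
structure IsMG11M {Ω : Type*} [MeasurableSpace Ω] (P : Measure Ω) (lam nu : ℝ) (G : Measure ℝ)
    (X S Z : ℕ → Ω → ℝ) : Prop where
  law_interarrival : ∀ n, HasLaw (X n) (expMeasure lam) P
  law_service : ∀ k, HasLaw (S k) G P
  law_decision : ∀ j, HasLaw (Z j) (expMeasure nu) P
  indep : iIndepFun (Sum.elim X (Sum.elim S Z) : ℕ ⊕ ℕ ⊕ ℕ → Ω → ℝ) P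

end UpdateDecision

end

/-!
The proof has two independent halves: the age has the claimed average over *time*, and the
decisions, being a Poisson process that is independent of the queue, see this time average.

*Time average.* Write `t_k` and `t_k'` for the arrival and the completion time of the `k`-th
successful update, and let `j_k` be the idle period that precedes `t_k`, so that `t_k' = (j_0 +
s_0) + ⋯ + (j_k + s_k)` (`arrivalTime_eq_sum`). A Poisson process seen from the end of a service is
again a Poisson process (`measurePreserving_residual`), so for any fixed service times the idle
periods are i.i.d. exponential of rate `λ` (`map_gap`); hence they are independent of the service
times. On the cycle `[t_k', t_{k+1}')` the age grows with slope one from `s_k` to the peak `L_k =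
s_k + j_{k+1} + s_{k+1}`, and the area under it is `(L_k ^ 2 - s_k ^ 2) / 2`. The law of large
numbers, applied to the even and to the odd cycles for the peaks, which are only `1`-dependent,
shows that the time average is `(𝔼 L ^ 2 - 𝔼 S ^ 2) / (2 (1 / λ + 1 / μ))`
(`tendsto_lintegral_cycleAge_div`).

*Sampling.* Fix the path `f` of the age. By Campbell's formulas (`lintegral_tsum_epoch`,
`lintegral_sq_tsum_epoch_le`), the sum of `f` over the decisions up to time `T` has mean `ν ∫_0^T
f` and variance at most `ν ∫_0^T f ^ 2`. Since `𝔼 S ^ 2 < ∞`, the squared peaks have a finite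
average, so that `f ≤ C √T` on `[0, T]` and the variance is at most of order `T ^ (3 / 2)`. Along
the times `T = (n + 1) ^ 4` the relative variances are therefore summable, which gives almost sure
convergence along this sequence; the sums are monotone in `T`, so it extends to all `T`
(`ae_tendsto_eventSum_div`). The same statement for `f = 1` says that the number of decisions up to
time `T` grows like `ν T`, and the ratio of the two limits no longer depends on `ν`. The initial
information matters for finitely many decisions only.
-/

open scoped ENNReal

noncomputable section

namespace UpdateDecision

/-! ### Sequences of independent random variables -/

/-- The law of a sequence of independent random variables with common law `ρ`. -/
abbrev iidLaw (ρ : Measure ℝ) : Measure (ℕ → ℝ) := Measure.infinitePi fun _ => ρ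

/-- The sequence with first term `u`, followed by the terms of `y`. -/
def consSeq (u : ℝ) (y : ℕ → ℝ) : ℕ → ℝ
  | 0 => u
  | n + 1 => y n

/-- The sequence without its first `n` terms. -/
def dropSeq (n : ℕ) (x : ℕ → ℝ) : ℕ → ℝ := fun i => x (n + i)

@[simp] lemma consSeq_zero (u : ℝ) (y : ℕ → ℝ) : consSeq u y 0 = u := rfl

@[simp] lemma consSeq_succ (u : ℝ) (y : ℕ → ℝ) (n : ℕ) : consSeq u y (n + 1) = y n := rfl

lemma dropSeq_one_consSeq (u : ℝ) (y : ℕ → ℝ) : dropSeq 1 (consSeq u y) = y := by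
  funext i; simp [dropSeq, Nat.add_comm 1 i]

lemma dropSeq_succ_consSeq (u : ℝ) (y : ℕ → ℝ) (n : ℕ) :
    dropSeq (n + 1) (consSeq u y) = dropSeq n y := by
  funext i; simp [dropSeq, Nat.add_right_comm n 1 i]

lemma measurable_consSeq : Measurable fun p : ℝ × (ℕ → ℝ) => consSeq p.1 p.2 := by
  refine measurable_pi_lambda _ fun n => ?_
  cases n with
  | zero => exact measurable_fst
  | succ n => exact (measurable_pi_apply n).comp measurable_snd

lemma measurable_dropSeq (n : ℕ) : Measurable (dropSeq n) :=
  measurable_pi_lambda _ fun i => measurable_pi_apply (n + i)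

lemma measurable_epoch (n : ℕ) : Measurable fun x : ℕ → ℝ => epoch x n := by
  unfold epoch
  exact Finset.measurable_fun_sum _ fun i _ => measurable_pi_apply i

lemma epoch_zero (x : ℕ → ℝ) : epoch x 0 = x 0 := by simp [epoch]

lemma epoch_succ (x : ℕ → ℝ) (n : ℕ) : epoch x (n + 1) = epoch x n + x (n + 1) := by
  simp only [epoch, Finset.sum_range_succ]

lemma epoch_consSeq_succ (u : ℝ) (y : ℕ → ℝ) (n : ℕ) :
    epoch (consSeq u y) (n + 1) = u + epoch y n := by
  simp only [epoch, Finset.sum_range_succ' _ (n + 1), consSeq_succ, consSeq_zero, add_comm u]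

lemma epoch_add_dropSeq (x : ℕ → ℝ) (n m : ℕ) :
    epoch x (n + 1 + m) = epoch x n + epoch (dropSeq (n + 1) x) m := by
  rw [epoch, epoch, epoch, add_assoc (n + 1) m 1, Finset.sum_range_add]
  rfl

/-- The law `iidLaw ρ` is determined by its values on the boxes over initial segments of `ℕ`. -/
lemma eq_iidLaw (ρ : Measure ℝ) [IsProbabilityMeasure ρ] {ν : Measure (ℕ → ℝ)}
    (h : ∀ (n : ℕ) (t : ℕ → Set ℝ), (∀ i, MeasurableSet (t i)) →
      ν ((Finset.range n : Set ℕ).pi t) = ∏ i ∈ Finset.range n, ρ (t i)) :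
    ν = iidLaw ρ := by
  classical
  refine Measure.eq_infinitePi _ fun s t ht => ?_
  obtain ⟨n, hn⟩ := s.exists_nat_subset_range
  set t' : ℕ → Set ℝ := fun i => if i ∈ s then t i else Set.univ with ht'
  have hm : ∀ i, MeasurableSet (t' i) := fun i => by
    simp only [ht']; split_ifs
    exacts [ht i, MeasurableSet.univ]
  have hbox : (s : Set ℕ).pi t = (Finset.range n : Set ℕ).pi t' := by
    ext x
    simp only [Set.mem_pi, ht']
    constructor
    · intro h i _
      split_ifs with hi
      exacts [h i hi, trivial]
    · intro h i hi
      have := h i (hn hi)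
      rwa [if_pos (by simpa using hi)] at this
  rw [hbox, h n t' hm, ← Finset.prod_subset hn]
  · exact Finset.prod_congr rfl fun i hi => by simp [ht', hi]
  · intro i _ hi
    simp [ht', hi]

/-- Prepending an independent term of law `ρ` to an i.i.d. sequence of law `ρ` gives again such a
sequence. -/
lemma measurePreserving_consSeq (ρ : Measure ℝ) [IsProbabilityMeasure ρ] :
    MeasurePreserving (fun p : ℝ × (ℕ → ℝ) => consSeq p.1 p.2)
      (ρ.prod (iidLaw ρ)) (iidLaw ρ) := by
  refine ⟨measurable_consSeq, eq_iidLaw ρ fun n t ht => ?_⟩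
  rw [Measure.map_apply measurable_consSeq
    (MeasurableSet.pi (Finset.range n).countable_toSet fun i _ => ht i)]
  cases n with
  | zero => simp
  | succ n =>
    have hpre : (fun p : ℝ × (ℕ → ℝ) => consSeq p.1 p.2) ⁻¹'
        ((Finset.range (n + 1) : Set ℕ).pi t)
        = t 0 ×ˢ ((Finset.range n : Set ℕ).pi fun i => t (i + 1)) := by
      ext p
      simp only [Set.mem_preimage, Set.mem_pi, Set.mem_prod, Finset.coe_range, Set.mem_Iio]
      constructor
      · exact fun h => ⟨h 0 n.succ_pos, fun i hi => h (i + 1) (Nat.succ_lt_succ hi)⟩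
      · rintro ⟨h0, h1⟩ (_ | i) hi
        exacts [h0, h1 i (Nat.lt_of_succ_lt_succ hi)]
    rw [hpre, Measure.prod_prod, Measure.infinitePi_pi _ fun i _ => ht (i + 1), mul_comm,
      ← Finset.prod_range_succ' fun i => ρ (t i)]

lemma lintegral_iidLaw (ρ : Measure ℝ) [IsProbabilityMeasure ρ] {f : (ℕ → ℝ) → ℝ≥0∞}
    (hf : Measurable f) :
    ∫⁻ x, f x ∂iidLaw ρ = ∫⁻ u, ∫⁻ y, f (consSeq u y) ∂iidLaw ρ ∂ρ := by
  rw [← (measurePreserving_consSeq ρ).lintegral_comp hf]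
  exact lintegral_prod (fun p : ℝ × (ℕ → ℝ) => f (consSeq p.1 p.2))
    (hf.comp measurable_consSeq).aemeasurable

lemma measurable_sumElim {ι κ : Type*} :
    Measurable fun p : (ι → ℝ) × (κ → ℝ) => (Sum.elim p.1 p.2 : ι ⊕ κ → ℝ) := by
  refine measurable_pi_lambda _ fun i => ?_
  cases i with
  | inl i => exact (measurable_pi_apply i).comp measurable_fst
  | inr i => exact (measurable_pi_apply i).comp measurable_snd

/-- Two independent families of independent random variables form a single independent family. -/
lemma map_sumElim_prod_infinitePi {ι κ : Type*} (γ : ι ⊕ κ → Measure ℝ)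
    [∀ i, IsProbabilityMeasure (γ i)] :
    ((Measure.infinitePi fun i => γ (Sum.inl i)).prod
        (Measure.infinitePi fun i => γ (Sum.inr i))).map
      (fun p => (Sum.elim p.1 p.2 : ι ⊕ κ → ℝ)) = Measure.infinitePi γ := by
  classical
  refine Measure.eq_infinitePi _ fun s t ht => ?_
  have hpre : (fun p : (ι → ℝ) × (κ → ℝ) => (Sum.elim p.1 p.2 : ι ⊕ κ → ℝ)) ⁻¹' (s : Set _).pi t
      = ((s.toLeft : Set ι).pi fun i => t (Sum.inl i)) ×ˢ
        ((s.toRight : Set κ).pi fun i => t (Sum.inr i)) := by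
    ext p
    simp [Set.mem_pi]
  rw [Measure.map_apply measurable_sumElim (MeasurableSet.pi s.countable_toSet fun i _ => ht i),
    hpre, Measure.prod_prod, Measure.infinitePi_pi _ fun i _ => ht _,
    Measure.infinitePi_pi _ fun i _ => ht _]
  conv_rhs => rw [← Finset.toLeft_disjSum_toRight (u := s), Finset.prod_disjSum]

/-- A product law on a disjoint union of index sets splits into a product of two such laws. -/
lemma map_infinitePi_sum {ι κ : Type*} (γ : ι ⊕ κ → Measure ℝ) [∀ i, IsProbabilityMeasure (γ i)] :
    (Measure.infinitePi γ).map (fun f => (fun i => f (Sum.inl i), fun i => f (Sum.inr i)))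
      = (Measure.infinitePi fun i => γ (Sum.inl i)).prod
        (Measure.infinitePi fun i => γ (Sum.inr i)) := by
  rw [← map_sumElim_prod_infinitePi γ, Measure.map_map (by fun_prop) measurable_sumElim]
  exact Measure.map_id

lemma iIndepFun_prod_iidLaw (ρ σ : Measure ℝ) [IsProbabilityMeasure ρ] [IsProbabilityMeasure σ] :
    iIndepFun (fun (i : ℕ ⊕ ℕ) (p : (ℕ → ℝ) × (ℕ → ℝ)) => (Sum.elim p.1 p.2 : ℕ ⊕ ℕ → ℝ) i)
      ((iidLaw ρ).prod (iidLaw σ)) := by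
  have hm : ∀ i : ℕ ⊕ ℕ, Measurable fun p : (ℕ → ℝ) × (ℕ → ℝ) =>
      (Sum.elim p.1 p.2 : ℕ ⊕ ℕ → ℝ) i := fun i => (measurable_pi_apply i).comp measurable_sumElim
  rw [iIndepFun_iff_map_fun_eq_infinitePi_map hm]
  have hmap : ∀ i : ℕ ⊕ ℕ, ((iidLaw ρ).prod (iidLaw σ)).map
      (fun p => (Sum.elim p.1 p.2 : ℕ ⊕ ℕ → ℝ) i)
        = (Sum.elim (fun _ => ρ) (fun _ => σ) : ℕ ⊕ ℕ → Measure ℝ) i := fun i => by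
    cases i with
    | inl i =>
      exact ((measurePreserving_eval_infinitePi (fun _ => ρ) i).comp
        (measurePreserving_fst (μ := iidLaw ρ) (ν := iidLaw σ))).map_eq
    | inr i =>
      exact ((measurePreserving_eval_infinitePi (fun _ => σ) i).comp
        (measurePreserving_snd (μ := iidLaw ρ) (ν := iidLaw σ))).map_eq
  simp_rw [hmap]
  have : ∀ i, IsProbabilityMeasure
      ((Sum.elim (fun _ => ρ) (fun _ => σ) : ℕ ⊕ ℕ → Measure ℝ) i) := by
    rintro (i | i)
    exacts [inferInstanceAs (IsProbabilityMeasure ρ), inferInstanceAs (IsProbabilityMeasure σ)]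
  exact map_sumElim_prod_infinitePi (Sum.elim (fun _ => ρ) (fun _ => σ) : ℕ ⊕ ℕ → Measure ℝ)

lemma measurePreserving_dropSeq (ρ : Measure ℝ) [IsProbabilityMeasure ρ] (n : ℕ) :
    MeasurePreserving (dropSeq n) (iidLaw ρ) (iidLaw ρ) :=
  ⟨measurable_dropSeq n,
    Measure.map_infinitePi_infinitePi_of_inj (P := fun _ : ℕ => ρ) (add_right_injective n)⟩

/-! ### Campbell's formulas for the Poisson process -/

lemma measurable_exponentialPDF (r : ℝ) : Measurable (exponentialPDF r) :=
  (measurable_exponentialPDFReal r).ennreal_ofReal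

lemma lintegral_expMeasure (r : ℝ) {f : ℝ → ℝ≥0∞} (hf : Measurable f) :
    ∫⁻ u, f u ∂expMeasure r = ∫⁻ u, exponentialPDF r u * f u := by
  have : expMeasure r = volume.withDensity (exponentialPDF r) := rfl
  rw [this, lintegral_withDensity_eq_lintegral_mul _ (measurable_exponentialPDF r) hf]
  rfl

/-- Memorylessness of the exponential law: the excess over a level `c ≥ 0`, on the event that this
level is reached, is again exponential. -/
lemma lintegral_expMeasure_excess (r : ℝ) {c : ℝ} (hc : 0 ≤ c) {g : ℝ → ℝ≥0∞}
    (hg : Measurable g) :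
    ∫⁻ u, (Set.Ici c).indicator (fun u => g (u - c)) u ∂expMeasure r
      = ENNReal.ofReal (Real.exp (-(r * c))) * ∫⁻ u, g u ∂expMeasure r := by
  have hgc : Measurable fun u => g (u - c) := hg.comp (measurable_id.sub_const c)
  have hm : Measurable fun u => exponentialPDF r u * g u := (measurable_exponentialPDF r).mul hg
  rw [lintegral_expMeasure r hg, lintegral_expMeasure r (hgc.indicator measurableSet_Ici),
    ← lintegral_add_right_eq_self _ c, ← lintegral_const_mul _ hm]
  refine lintegral_congr fun v => ?_
  by_cases hv : 0 ≤ v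
  · have h1 : v + c ∈ Set.Ici c := by simpa using hv
    rw [Set.indicator_of_mem h1, exponentialPDF_of_nonneg hv,
      exponentialPDF_of_nonneg (by positivity),
      add_sub_cancel_right, ← mul_assoc, ← ENNReal.ofReal_mul (Real.exp_nonneg _)]
    congr 2
    rw [mul_left_comm, ← Real.exp_add]
    ring_nf
  · have h1 : v + c ∉ Set.Ici c := by simpa using hv
    rw [Set.indicator_of_notMem h1, exponentialPDF_of_neg (not_le.1 hv)]
    simp

/-- The density of the `n`-th event time of a Poisson process of rate `r`. -/
def erlangDensity (r : ℝ) (n : ℕ) (t : ℝ) : ℝ≥0∞ :=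
  ENNReal.ofReal (if 0 ≤ t then r ^ (n + 1) * t ^ n / n.factorial * Real.exp (-(r * t)) else 0)

lemma measurable_erlangDensity (r : ℝ) (n : ℕ) : Measurable (erlangDensity r n) := by
  refine ENNReal.measurable_ofReal.comp (Measurable.ite measurableSet_Ici ?_ measurable_const)
  fun_prop

lemma lintegral_exponentialPDF_mul_erlangDensity {r : ℝ} (hr : 0 < r) (n : ℕ) (v : ℝ) :
    ∫⁻ u, exponentialPDF r u * erlangDensity r n (v - u) = erlangDensity r (n + 1) v := by
  have h1 : ∀ u, exponentialPDF r u * erlangDensity r n (v - u)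
      = (Set.Icc 0 v).indicator (fun u => ENNReal.ofReal
        (r ^ (n + 2) / n.factorial * Real.exp (-(r * v)) * (v - u) ^ n)) u := fun u => by
    by_cases hu : 0 ≤ u
    · by_cases huv : u ≤ v
      · rw [Set.indicator_of_mem (show u ∈ Set.Icc 0 v from ⟨hu, huv⟩), exponentialPDF_of_nonneg hu,
          erlangDensity, if_pos (sub_nonneg.2 huv), ← ENNReal.ofReal_mul (by positivity)]
        congr 1
        have : Real.exp (-(r * v)) = Real.exp (-(r * u)) * Real.exp (-(r * (v - u))) := by
          rw [← Real.exp_add]; ring_nf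
        rw [this]; ring
      · rw [Set.indicator_of_notMem (fun h => huv h.2), erlangDensity,
          if_neg (fun h => huv (sub_nonneg.1 h))]
        simp
    · rw [Set.indicator_of_notMem (fun h => hu h.1), exponentialPDF_of_neg (not_le.1 hu), zero_mul]
  simp_rw [h1]
  rw [lintegral_indicator measurableSet_Icc]
  by_cases hv : 0 ≤ v
  · rw [← ofReal_integral_eq_lintegral_ofReal, erlangDensity, if_pos hv]
    · congr 1
      rw [integral_Icc_eq_integral_Ioc, ← intervalIntegral.integral_of_le hv,
        intervalIntegral.integral_const_mul, intervalIntegral.integral_comp_sub_left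
          (fun x => x ^ n) v]
      simp only [sub_self, sub_zero, integral_pow, Nat.factorial_succ, Nat.cast_mul, Nat.cast_succ]
      have : (n.factorial : ℝ) ≠ 0 := by positivity
      have : (n + 1 : ℝ) ≠ 0 := by positivity
      field_simp
      simp
    · exact (Continuous.integrableOn_Icc (by fun_prop))
    · filter_upwards [ae_restrict_mem measurableSet_Icc] with u hu
      have := sub_nonneg.2 hu.2
      simp only [Pi.zero_apply]
      positivity
  · rw [Set.Icc_eq_empty hv, erlangDensity, if_neg hv]
    simp

lemma lintegral_epoch {r : ℝ} (hr : 0 < r) (n : ℕ) {f : ℝ → ℝ≥0∞} (hf : Measurable f) :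
    ∫⁻ z, f (epoch z n) ∂iidLaw (expMeasure r) = ∫⁻ t, erlangDensity r n t * f t := by
  have := isProbabilityMeasure_expMeasure hr
  induction n generalizing f with
  | zero =>
    have : ∀ t, erlangDensity r 0 t = exponentialPDF r t := fun t => by
      rw [exponentialPDF_eq, erlangDensity]; simp
    simp_rw [epoch_zero, this]
    rw [← lintegral_expMeasure r hf, 
      lintegral_iidLaw _ (f := fun z => f (z 0)) (hf.comp (measurable_pi_apply 0))]
    simp
  | succ n ih =>
    rw [lintegral_iidLaw _ (f := fun z => f (epoch z (n + 1))) (hf.comp (measurable_epoch (n + 1)))]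
    simp_rw [epoch_consSeq_succ]
    have hme := measurable_erlangDensity r n
    have h1 : ∀ u, ∫⁻ z, f (u + epoch z n) ∂iidLaw (expMeasure r)
        = ∫⁻ v, erlangDensity r n (v - u) * f v := fun u => by
      rw [ih (f := fun t => f (u + t)) (hf.comp (measurable_const_add u)),
        ← lintegral_sub_right_eq_self _ u]
      simp
    simp_rw [h1]
    rw [lintegral_expMeasure]
    · have h2 : ∀ u, exponentialPDF r u * ∫⁻ v, erlangDensity r n (v - u) * f v
          = ∫⁻ v, exponentialPDF r u * (erlangDensity r n (v - u) * f v) := fun u => by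
        rw [lintegral_const_mul]
        exact (hme.comp (measurable_id.sub_const u)).mul hf
      simp_rw [h2]
      rw [lintegral_lintegral_swap]
      · refine lintegral_congr fun v => ?_
        simp_rw [← mul_assoc]
        rw [lintegral_mul_const, lintegral_exponentialPDF_mul_erlangDensity hr]
        exact (measurable_exponentialPDF r).mul (hme.comp (measurable_const.sub measurable_id))
      · refine Measurable.aemeasurable ?_
        exact ((measurable_exponentialPDF r).comp measurable_fst).mul
          ((hme.comp (measurable_snd.sub measurable_fst)).mul (hf.comp measurable_snd))
    · refine Measurable.lintegral_prod_right'
        (f := fun p : ℝ × ℝ => erlangDensity r n (p.2 - p.1) * f p.2) ?_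
      exact (hme.comp (measurable_snd.sub measurable_fst)).mul (hf.comp measurable_snd)

lemma tsum_erlangDensity {r : ℝ} (hr : 0 < r) (t : ℝ) :
    ∑' n, erlangDensity r n t = (Set.Ici 0).indicator (fun _ => ENNReal.ofReal r) t := by
  by_cases ht : 0 ≤ t
  · rw [Set.indicator_of_mem (show t ∈ Set.Ici 0 from ht)]
    have h : HasSum (fun n : ℕ => r ^ (n + 1) * t ^ n / n.factorial * Real.exp (-(r * t))) r := by
      have h0 := NormedSpace.expSeries_div_hasSum_exp (r * t)
      rw [← Real.exp_eq_exp_ℝ] at h0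
      have h1 := (h0.mul_left r).mul_right (Real.exp (-(r * t)))
      rw [mul_assoc, ← Real.exp_add, add_neg_cancel, Real.exp_zero, mul_one] at h1
      refine h1.congr_fun fun n => ?_
      rw [mul_pow, pow_succ]; ring
    simp_rw [erlangDensity, if_pos ht]
    rw [← ENNReal.ofReal_tsum_of_nonneg (fun n => by positivity) h.summable, h.tsum_eq]
  · rw [Set.indicator_of_notMem (show t ∉ Set.Ici 0 from ht)]
    simp [erlangDensity, ht]

/-- Campbell's formula for the Poisson process: the mean of `∑ f (τ_j)` is `r ∫ f`. -/
lemma lintegral_tsum_epoch {r : ℝ} (hr : 0 < r) {f : ℝ → ℝ≥0∞} (hf : Measurable f) :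
    ∫⁻ z, ∑' n, f (epoch z n) ∂iidLaw (expMeasure r)
      = ENNReal.ofReal r * ∫⁻ t in Set.Ici 0, f t := by
  have hm : ∀ n, Measurable fun z : ℕ → ℝ => f (epoch z n) := fun n => hf.comp (measurable_epoch n)
  rw [lintegral_tsum fun n => (hm n).aemeasurable]
  simp_rw [lintegral_epoch hr _ hf]
  have hm' : ∀ n, Measurable fun t => erlangDensity r n t * f t := fun n =>
    (measurable_erlangDensity r n).mul hf
  rw [← lintegral_tsum fun n => (hm' n).aemeasurable]
  simp_rw [ENNReal.tsum_mul_right, tsum_erlangDensity hr]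
  rw [← lintegral_indicator measurableSet_Ici,
    ← lintegral_const_mul _ (hf.indicator measurableSet_Ici)]
  refine lintegral_congr fun t => ?_
  by_cases ht : t ∈ Set.Ici (0 : ℝ) <;> simp [ht]

/-- The sequence of inter-event times after the event `n` is independent of the time of that
event. -/
lemma lintegral_epoch_dropSeq (ρ : Measure ℝ) [IsProbabilityMeasure ρ] (n : ℕ)
    {φ : ℝ × (ℕ → ℝ) → ℝ≥0∞} (hφ : Measurable φ) :
    ∫⁻ z, φ (epoch z n, dropSeq (n + 1) z) ∂iidLaw ρ
      = ∫⁻ z, ∫⁻ y, φ (epoch z n, y) ∂iidLaw ρ ∂iidLaw ρ := by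
  have hm1 : Measurable fun z : ℕ → ℝ => φ (epoch z n, dropSeq (n + 1) z) :=
    hφ.comp ((measurable_epoch n).prodMk (measurable_dropSeq (n + 1)))
  have hm2 : Measurable fun z : ℕ → ℝ => ∫⁻ y, φ (epoch z n, y) ∂iidLaw ρ :=
    (hφ.lintegral_prod_right' (ν := iidLaw ρ)).comp (measurable_epoch n)
  rw [lintegral_iidLaw ρ hm1, lintegral_iidLaw ρ hm2]
  induction n generalizing φ with
  | zero =>
    simp_rw [epoch_zero, zero_add, dropSeq_one_consSeq]
    simp
  | succ n ih =>
    simp_rw [epoch_consSeq_succ, dropSeq_succ_consSeq]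
    refine lintegral_congr fun u => ?_
    have hφ' : Measurable fun p : ℝ × (ℕ → ℝ) => φ (u + p.1, p.2) :=
      hφ.comp ((measurable_fst.const_add u).prodMk measurable_snd)
    have h1 : Measurable fun z : ℕ → ℝ => φ (u + epoch z n, dropSeq (n + 1) z) :=
      hφ'.comp ((measurable_epoch n).prodMk (measurable_dropSeq (n + 1)))
    have h2 : Measurable fun z : ℕ → ℝ => ∫⁻ y, φ (u + epoch z n, y) ∂iidLaw ρ :=
      (hφ'.lintegral_prod_right' (ν := iidLaw ρ)).comp (measurable_epoch n)
    have := ih hφ' h1 h2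
    rwa [← lintegral_iidLaw ρ h1, ← lintegral_iidLaw ρ h2] at this

lemma sq_tsum_le (a : ℕ → ℝ≥0∞) :
    (∑' n, a n) ^ 2 ≤ ∑' n, a n ^ 2 + 2 * ∑' n, a n * ∑' l, a (n + 1 + l) := by
  have hfin : ∀ n, (∑ i ∈ Finset.range n, a i) ^ 2
      ≤ ∑ i ∈ Finset.range n, a i ^ 2
        + 2 * ∑ i ∈ Finset.range n, a i * ∑ l ∈ Finset.Ico (i + 1) n, a l := fun n => by
    induction n with
    | zero => simp
    | succ n ih =>
      have h : ∑ i ∈ Finset.range (n + 1), a i * ∑ l ∈ Finset.Ico (i + 1) (n + 1), a l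
          = ∑ i ∈ Finset.range n, a i * ∑ l ∈ Finset.Ico (i + 1) n, a l
            + (∑ i ∈ Finset.range n, a i) * a n := by
        rw [Finset.sum_range_succ, Finset.Ico_self, Finset.sum_empty, mul_zero, add_zero,
          Finset.sum_mul, ← Finset.sum_add_distrib]
        refine Finset.sum_congr rfl fun i hi => ?_
        rw [Finset.sum_Ico_succ_top (Finset.mem_range.1 hi), mul_add]
      rw [h, Finset.sum_range_succ, Finset.sum_range_succ, add_sq, mul_add]
      calc _ ≤ (∑ i ∈ Finset.range n, a i ^ 2
        + 2 * ∑ i ∈ Finset.range n, a i * ∑ l ∈ Finset.Ico (i + 1) n, a l)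
          + 2 * (∑ i ∈ Finset.range n, a i) * a n + a n ^ 2 := by gcongr
        _ = _ := by ring
  have hlim : Tendsto (fun n => (∑ i ∈ Finset.range n, a i) ^ 2) atTop (𝓝 ((∑' n, a n) ^ 2)) :=
    ((ENNReal.continuous_pow 2).tendsto _).comp ENNReal.summable.hasSum.tendsto_sum_nat
  refine le_of_tendsto' hlim fun n => (hfin n).trans ?_
  gcongr
  · exact ENNReal.sum_le_tsum _
  · refine le_trans (Finset.sum_le_sum fun i _ => ?_) (ENNReal.sum_le_tsum _)
    gcongr
    rw [Finset.sum_Ico_eq_sum_range]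
    exact ENNReal.sum_le_tsum _

/-- By symmetry, the integral of `f t * f s` over `t < s` is at most half of that over the plane. -/
lemma two_mul_lintegral_mul_tail_le {f : ℝ → ℝ≥0∞} (hf : Measurable f) :
    2 * ∫⁻ t in Set.Ici 0, f t * ∫⁻ u in Set.Ici 0, f (t + u)
      ≤ (∫⁻ t in Set.Ici 0, f t) ^ 2 := by
  set h : ℝ → ℝ≥0∞ := (Set.Ici 0).indicator f with hh
  have hm : Measurable h := hf.indicator measurableSet_Ici
  set A : ℝ → ℝ → ℝ≥0∞ := fun t s => if t < s then h t * h s else 0 with hA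
  have hAm : Measurable (Function.uncurry A) := by
    refine Measurable.ite (measurableSet_lt measurable_fst measurable_snd) ?_ measurable_const
    exact (hm.comp measurable_fst).mul (hm.comp measurable_snd)
  have h1 : ∫⁻ t in Set.Ici 0, f t * ∫⁻ u in Set.Ici 0, f (t + u) = ∫⁻ t, ∫⁻ s, A t s := by
    rw [← lintegral_indicator measurableSet_Ici]
    refine lintegral_congr fun t => ?_
    by_cases ht : t ∈ Set.Ici (0 : ℝ)
    · have h2 : ∫⁻ u in Set.Ici 0, f (t + u) = ∫⁻ s, if t < s then h s else 0 := by
        rw [setLIntegral_congr (Ioi_ae_eq_Ici (a := (0 : ℝ))).symm,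
          ← lintegral_indicator measurableSet_Ioi,
          ← lintegral_add_left_eq_self (fun s => if t < s then h s else 0) t]
        refine lintegral_congr fun u => ?_
        by_cases hu : 0 < u
        · have h0 : t + u ∈ Set.Ici (0 : ℝ) := add_nonneg ht hu.le
          rw [Set.indicator_of_mem (show u ∈ Set.Ioi 0 from hu), hh, Set.indicator_of_mem h0,
            if_pos (lt_add_of_pos_right t hu)]
        · simp [hu]
      have h3 : ∀ s, A t s = f t * (if t < s then h s else 0) := fun s => by
        simp only [hA, mul_ite, mul_zero, hh, Set.indicator_of_mem ht]
      rw [Set.indicator_of_mem ht, h2]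
      simp_rw [h3]
      rw [lintegral_const_mul]
      exact Measurable.ite measurableSet_Ioi hm measurable_const
    · have h3 : ∀ s, A t s = 0 := fun s => by
        simp only [hA, hh, Set.indicator_of_notMem ht, zero_mul, ite_self]
      simp [ht, h3]
  have h2 : ∫⁻ t, ∫⁻ s, A t s = ∫⁻ t, ∫⁻ s, A s t :=
    lintegral_lintegral_swap hAm.aemeasurable
  have h4 : Measurable fun t => ∫⁻ s, A t s := hAm.lintegral_prod_right'
  have h5 : ∀ t, Measurable (A t) := fun t => hAm.comp (measurable_const.prodMk measurable_id)
  rw [← lintegral_indicator (f := f) measurableSet_Ici, h1, two_mul]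
  nth_rewrite 2 [h2]
  rw [← lintegral_add_left h4, sq, ← lintegral_mul_const _ hm]
  refine lintegral_mono fun t => ?_
  rw [← lintegral_add_left (h5 t), ← lintegral_const_mul _ hm]
  refine lintegral_mono fun s => ?_
  simp only [hA]
  rcases lt_trichotomy t s with hts | hts | hts
  · simp [hts, hts.not_gt, hh]
  · simp [hts]
  · simp [hts, hts.not_gt, hh, mul_comm]

/-- The second moment form of Campbell's formula: the variance of `∑ f (τ_j)` is at most
`r ∫ f ^ 2`. -/
lemma lintegral_sq_tsum_epoch_le {r : ℝ} (hr : 0 < r) {f : ℝ → ℝ≥0∞} (hf : Measurable f) :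
    ∫⁻ z, (∑' n, f (epoch z n)) ^ 2 ∂iidLaw (expMeasure r)
      ≤ ENNReal.ofReal r * (∫⁻ t in Set.Ici 0, f t ^ 2)
        + (ENNReal.ofReal r * ∫⁻ t in Set.Ici 0, f t) ^ 2 := by
  have := isProbabilityMeasure_expMeasure hr
  have hm : ∀ n, Measurable fun z : ℕ → ℝ => f (epoch z n) := fun n => hf.comp (measurable_epoch n)
  have htail : ∀ n z, ∑' l, f (epoch z (n + 1 + l))
      = ∑' l, f (epoch z n + epoch (dropSeq (n + 1) z) l) := fun n z => by
    simp_rw [epoch_add_dropSeq]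
  have hmt : Measurable fun t : ℝ => ∫⁻ u in Set.Ici 0, f (t + u) :=
    Measurable.lintegral_prod_right' (f := fun p : ℝ × ℝ => f (p.1 + p.2))
      (hf.comp (measurable_fst.add measurable_snd))
  have hcross : ∀ n, ∫⁻ z, f (epoch z n) * ∑' l, f (epoch z (n + 1 + l)) ∂iidLaw (expMeasure r)
      = ∫⁻ z, f (epoch z n) * (ENNReal.ofReal r * ∫⁻ u in Set.Ici 0, f (epoch z n + u))
        ∂iidLaw (expMeasure r) := fun n => by
    simp_rw [htail]
    have hφ : Measurable fun p : ℝ × (ℕ → ℝ) => f p.1 * ∑' l, f (p.1 + epoch p.2 l) := by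
      refine (hf.comp measurable_fst).mul (Measurable.tsum fun l => ?_)
      exact hf.comp (measurable_fst.add ((measurable_epoch l).comp measurable_snd))
    rw [lintegral_epoch_dropSeq (expMeasure r) n hφ]
    refine lintegral_congr fun z => ?_
    simp only
    rw [lintegral_const_mul, lintegral_tsum_epoch hr (f := fun t => f (epoch z n + t))
      (hf.comp (measurable_const_add _))]
    exact Measurable.tsum fun l => hf.comp ((measurable_epoch l).const_add _)
  calc ∫⁻ z, (∑' n, f (epoch z n)) ^ 2 ∂iidLaw (expMeasure r)
      ≤ ∫⁻ z, (∑' n, f (epoch z n) ^ 2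
          + 2 * ∑' n, f (epoch z n) * ∑' l, f (epoch z (n + 1 + l))) ∂iidLaw (expMeasure r) :=
        lintegral_mono fun z => sq_tsum_le _
    _ = ENNReal.ofReal r * (∫⁻ t in Set.Ici 0, f t ^ 2) + 2 * (ENNReal.ofReal r *
          ∫⁻ t in Set.Ici 0, f t * (ENNReal.ofReal r * ∫⁻ u in Set.Ici 0, f (t + u))) := by
        have hmc : ∀ n, Measurable fun z : ℕ → ℝ =>
            f (epoch z n) * ∑' l, f (epoch z (n + 1 + l)) := fun n =>
          (hm n).mul (Measurable.tsum fun l => hm _)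
        rw [lintegral_add_left (Measurable.tsum fun n => (hm n).pow_const 2),
          lintegral_const_mul _ (Measurable.tsum hmc),
          lintegral_tsum_epoch hr (f := fun t => f t ^ 2) (hf.pow_const 2),
          lintegral_tsum fun n => (hmc n).aemeasurable]
        simp_rw [hcross]
        have hmc' : ∀ n, Measurable fun z : ℕ → ℝ =>
            f (epoch z n) * (ENNReal.ofReal r * ∫⁻ u in Set.Ici 0, f (epoch z n + u)) := fun n =>
          (hm n).mul ((hmt.comp (measurable_epoch n)).const_mul _)
        rw [← lintegral_tsum fun n => (hmc' n).aemeasurable,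
          lintegral_tsum_epoch hr
            (f := fun t => f t * (ENNReal.ofReal r * ∫⁻ u in Set.Ici 0, f (t + u)))
            (hf.mul (hmt.const_mul _))]
    _ ≤ _ := by
        simp_rw [mul_left_comm (f _) (ENNReal.ofReal r)]
        have hft : Measurable fun t => f t * ∫⁻ u in Set.Ici 0, f (t + u) := hf.mul hmt
        rw [lintegral_const_mul _ hft]
        gcongr
        calc _ = ENNReal.ofReal r ^ 2 *
              (2 * ∫⁻ t in Set.Ici 0, f t * ∫⁻ u in Set.Ici 0, f (t + u)) := by ring
          _ ≤ ENNReal.ofReal r ^ 2 * (∫⁻ t in Set.Ici 0, f t) ^ 2 := by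
              gcongr; exact two_mul_lintegral_mul_tail_le hf
          _ = _ := by ring

/-! ### Memorylessness and the idle periods of the server -/

/-- A Poisson process has finitely many events, on average `r T`, up to any time `T`. -/
lemma ae_tendsto_epoch {r : ℝ} (hr : 0 < r) :
    ∀ᵐ z ∂iidLaw (expMeasure r), Tendsto (epoch z) atTop atTop := by
  have := isProbabilityMeasure_expMeasure hr
  have h : ∀ T : ℕ, ∀ᵐ z ∂iidLaw (expMeasure r),
      ∑' n, (Set.Iic (T : ℝ)).indicator (fun _ => (1 : ℝ≥0∞)) (epoch z n) < ∞ := fun T => by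
    have hm : Measurable ((Set.Iic (T : ℝ)).indicator fun _ => (1 : ℝ≥0∞)) :=
      measurable_const.indicator measurableSet_Iic
    refine ae_lt_top (Measurable.tsum fun n => hm.comp (measurable_epoch n)) ?_
    rw [lintegral_tsum_epoch hr hm, lintegral_indicator measurableSet_Iic,
      setLIntegral_one, Measure.restrict_apply measurableSet_Iic]
    refine ENNReal.mul_ne_top ENNReal.ofReal_ne_top ?_
    have : Set.Iic (T : ℝ) ∩ Set.Ici 0 = Set.Icc 0 (T : ℝ) := by
      rw [Set.inter_comm, Set.Ici_inter_Iic]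
    rw [this, Real.volume_Icc]
    exact ENNReal.ofReal_ne_top
  filter_upwards [ae_all_iff.2 h] with z hz
  refine tendsto_atTop.2 fun b => ?_
  obtain ⟨T, hT⟩ := exists_nat_ge b
  have h0 := ENNReal.tendsto_cofinite_zero_of_tsum_ne_top (hz T).ne
  rw [Nat.cofinite_eq_atTop] at h0
  filter_upwards [h0.eventually_lt_const zero_lt_one] with n hn
  by_contra hlt
  rw [Set.indicator_of_mem (show epoch z n ∈ Set.Iic (T : ℝ) from (not_le.1 hlt).le.trans hT)] at hn
  exact lt_irrefl _ hn

/-- The set of the sequences whose first event at time `c` or later is the event `n`. -/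
def firstReach (n : ℕ) (c : ℝ) : Set (ℕ → ℝ) := {y | c ≤ epoch y n ∧ ∀ i < n, epoch y i < c}

/-- The number of the first event at time `c` or later; junk value `0` if there is none. -/
def firstIndex (c : ℝ) (y : ℕ → ℝ) : ℕ := sInf {n | c ≤ epoch y n}

/-- The inter-event times seen from time `c`: the first one is the time from `c` to the first
event at time `c` or later. -/
def residual (c : ℝ) (y : ℕ → ℝ) : ℕ → ℝ :=
  consSeq (epoch y (firstIndex c y) - c) (dropSeq (firstIndex c y + 1) y)

lemma firstIndex_of_mem {n : ℕ} {c : ℝ} {y : ℕ → ℝ} (h : y ∈ firstReach n c) :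
    firstIndex c y = n := by
  refine le_antisymm (Nat.sInf_le h.1) ?_
  by_contra hlt
  exact (h.2 _ (not_le.1 hlt)).not_ge (Nat.sInf_mem (s := {n | c ≤ epoch y n}) ⟨n, h.1⟩)

lemma mem_firstReach {c : ℝ} {y : ℕ → ℝ} (h : ∃ n, c ≤ epoch y n) :
    y ∈ firstReach (firstIndex c y) c :=
  ⟨Nat.sInf_mem (s := {n | c ≤ epoch y n}) h, fun _ hi => not_le.1 (Nat.notMem_of_lt_sInf hi)⟩

lemma measurableSet_firstReach (n : ℕ) :
    MeasurableSet {p : ℝ × (ℕ → ℝ) | p.2 ∈ firstReach n p.1} := by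
  have : ∀ i, Measurable fun p : ℝ × (ℕ → ℝ) => epoch p.2 i := fun i =>
    (measurable_epoch i).comp measurable_snd
  refine (measurableSet_le measurable_fst (this n)).inter ?_
  have h2 : {p : ℝ × (ℕ → ℝ) | ∀ i < n, epoch p.2 i < p.1}
      = ⋂ i, ⋂ _ : i < n, {p : ℝ × (ℕ → ℝ) | epoch p.2 i < p.1} := by
    ext p; simp
  have h3 : MeasurableSet {p : ℝ × (ℕ → ℝ) | ∀ i < n, epoch p.2 i < p.1} := by
    rw [h2]
    exact MeasurableSet.iInter fun i => MeasurableSet.iInter fun _ =>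
      measurableSet_lt (this i) measurable_fst
  exact h3

lemma measurable_firstIndex : Measurable fun p : ℝ × (ℕ → ℝ) => firstIndex p.1 p.2 := by
  refine measurable_to_countable' fun n => ?_
  have h : (fun p : ℝ × (ℕ → ℝ) => firstIndex p.1 p.2) ⁻¹' {n}
      = {p | p.2 ∈ firstReach n p.1} ∪ ((⋃ m, {p | p.2 ∈ firstReach m p.1})ᶜ ∩ {_p | n = 0}) := by
    ext p
    simp only [Set.mem_preimage, Set.mem_singleton_iff, Set.mem_union, Set.mem_inter_iff,
      Set.mem_compl_iff, Set.mem_iUnion, Set.mem_ofPred_eq]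
    by_cases hp : ∃ m, p.1 ≤ epoch p.2 m
    · have hm := mem_firstReach hp
      constructor
      · rintro rfl; exact Or.inl hm
      · rintro (h | h)
        exacts [firstIndex_of_mem h, absurd ⟨_, hm⟩ h.1]
    · have h1 : ∀ m, p.2 ∉ firstReach m p.1 := fun m hm => hp ⟨m, hm.1⟩
      have h2 : firstIndex p.1 p.2 = 0 := by
        have : {m | p.1 ≤ epoch p.2 m} = ∅ := Set.eq_empty_of_forall_notMem fun m hm => hp ⟨m, hm⟩
        rw [firstIndex, this, Nat.sInf_empty]
      simp [h1, h2, eq_comm]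
  rw [h]
  exact (measurableSet_firstReach n).union
    ((MeasurableSet.iUnion measurableSet_firstReach).compl.inter (MeasurableSet.const _))

lemma measurable_residual : Measurable fun p : ℝ × (ℕ → ℝ) => residual p.1 p.2 := by
  have h1 : Measurable fun q : ℕ × (ℝ × (ℕ → ℝ)) =>
      consSeq (epoch q.2.2 q.1 - q.2.1) (dropSeq (q.1 + 1) q.2.2) := by
    refine measurable_from_prod_countable_right fun n => ?_
    exact measurable_consSeq.comp ((((measurable_epoch n).comp measurable_snd).sub
      measurable_fst).prodMk ((measurable_dropSeq (n + 1)).comp measurable_snd))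
  exact h1.comp (measurable_firstIndex.prodMk measurable_id)

lemma epoch_residual (c : ℝ) (y : ℕ → ℝ) (m : ℕ) :
    epoch (residual c y) m = epoch y (firstIndex c y + m) - c := by
  cases m with
  | zero => simp [epoch_zero, residual]
  | succ m =>
    rw [residual, epoch_consSeq_succ, ← add_assoc, add_right_comm, epoch_add_dropSeq]
    ring

/-- The part of the law of the residual sequence that comes from the event that the level `c` is
first reached by the event `n`. The proof is by induction on `n`, by conditioning on the first event;
memorylessness is used for `n = 0` only. -/
lemma lintegral_indicator_firstReach {r : ℝ} (hr : 0 < r) (n : ℕ) {c : ℝ} (hc : 0 ≤ c)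
    {g : (ℕ → ℝ) → ℝ≥0∞} (hg : Measurable g) :
    ∫⁻ y, (firstReach n c).indicator
        (fun y => g (consSeq (epoch y n - c) (dropSeq (n + 1) y))) y ∂iidLaw (expMeasure r)
      = iidLaw (expMeasure r) (firstReach n c) * ∫⁻ y, g y ∂iidLaw (expMeasure r) := by
  have := isProbabilityMeasure_expMeasure hr
  have hS : ∀ (n : ℕ) (c : ℝ), MeasurableSet (firstReach n c) := fun n c =>
    measurableSet_firstReach n |>.preimage (measurable_const.prodMk measurable_id :
      Measurable fun y : ℕ → ℝ => (c, y))
  have hm : ∀ (n : ℕ) (c : ℝ) (g : (ℕ → ℝ) → ℝ≥0∞), Measurable g → Measurable fun y : ℕ → ℝ =>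
      (firstReach n c).indicator (fun y => g (consSeq (epoch y n - c) (dropSeq (n + 1) y))) y :=
    fun n c g hg => (hg.comp (measurable_consSeq.comp
      (((measurable_epoch n).sub_const c).prodMk (measurable_dropSeq (n + 1))))).indicator (hS n c)
  suffices H : ∫⁻ y, (firstReach n c).indicator
        (fun y => g (consSeq (epoch y n - c) (dropSeq (n + 1) y))) y ∂iidLaw (expMeasure r)
      = (∫⁻ y, (firstReach n c).indicator (fun _ => 1) y ∂iidLaw (expMeasure r))
        * ∫⁻ y, g y ∂iidLaw (expMeasure r) by
    rw [H, lintegral_indicator_const (hS n c), one_mul]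
  induction n generalizing c with
  | zero =>
    have key : ∀ g : (ℕ → ℝ) → ℝ≥0∞, Measurable g →
        ∫⁻ y, (firstReach 0 c).indicator
          (fun y => g (consSeq (epoch y 0 - c) (dropSeq (0 + 1) y))) y ∂iidLaw (expMeasure r)
        = ENNReal.ofReal (Real.exp (-(r * c))) * ∫⁻ y, g y ∂iidLaw (expMeasure r) := fun g hg => by
      have hg' : Measurable fun u : ℝ => ∫⁻ y, g (consSeq u y) ∂iidLaw (expMeasure r) :=
        (hg.comp measurable_consSeq).lintegral_prod_right'
      rw [lintegral_iidLaw _ (hm 0 c g hg), lintegral_iidLaw _ hg,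
        ← lintegral_expMeasure_excess r hc hg']
      refine lintegral_congr fun u => ?_
      by_cases hu : c ≤ u
      · rw [Set.indicator_of_mem (show u ∈ Set.Ici c from hu)]
        refine lintegral_congr fun y => ?_
        rw [Set.indicator_of_mem, epoch_zero, zero_add, dropSeq_one_consSeq, consSeq_zero]
        exact ⟨by simpa [epoch_zero] using hu, fun i hi => absurd hi i.not_lt_zero⟩
      · rw [Set.indicator_of_notMem (show u ∉ Set.Ici c from hu)]
        refine (lintegral_congr fun y => Set.indicator_of_notMem (fun h => hu ?_) _).trans
          lintegral_zero
        simpa [epoch_zero] using h.1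
    have h1 := key (fun _ => 1) measurable_const
    rw [lintegral_one, measure_univ, mul_one] at h1
    rw [key g hg, h1]
  | succ n ih =>
    have key : ∀ g : (ℕ → ℝ) → ℝ≥0∞, Measurable g →
        ∫⁻ y, (firstReach (n + 1) c).indicator
          (fun y => g (consSeq (epoch y (n + 1) - c) (dropSeq (n + 1 + 1) y))) y
            ∂iidLaw (expMeasure r)
        = ∫⁻ u, (Set.Iio c).indicator (fun u => ∫⁻ y, (firstReach n (c - u)).indicator
          (fun y => g (consSeq (epoch y n - (c - u)) (dropSeq (n + 1) y))) y
            ∂iidLaw (expMeasure r)) u ∂expMeasure r := fun g hg => by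
      rw [lintegral_iidLaw _ (hm (n + 1) c g hg)]
      refine lintegral_congr fun u => ?_
      have hiff : ∀ y, consSeq u y ∈ firstReach (n + 1) c ↔ u < c ∧ y ∈ firstReach n (c - u) :=
        fun y => by
          simp only [firstReach, Set.mem_ofPred_eq, epoch_consSeq_succ]
          constructor
          · rintro ⟨h1, h2⟩
            refine ⟨by simpa [epoch_zero] using h2 0 n.succ_pos, by linarith, fun i hi => ?_⟩
            have := h2 (i + 1) (Nat.succ_lt_succ hi)
            rw [epoch_consSeq_succ] at this
            linarith
          · rintro ⟨h1, h2, h3⟩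
            refine ⟨by linarith, ?_⟩
            rintro (_ | i) hi
            · simpa [epoch_zero] using h1
            · have := h3 i (Nat.lt_of_succ_lt_succ hi)
              rw [epoch_consSeq_succ]
              linarith
      by_cases hu : u < c
      · rw [Set.indicator_of_mem (show u ∈ Set.Iio c from hu)]
        refine lintegral_congr fun y => ?_
        by_cases hy : y ∈ firstReach n (c - u)
        · rw [Set.indicator_of_mem hy, Set.indicator_of_mem ((hiff y).2 ⟨hu, hy⟩),
            epoch_consSeq_succ, dropSeq_succ_consSeq]
          congr 2
          ring
        · rw [Set.indicator_of_notMem hy, Set.indicator_of_notMem fun h => hy ((hiff y).1 h).2]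
      · rw [Set.indicator_of_notMem (show u ∉ Set.Iio c from hu)]
        exact (lintegral_congr fun y =>
          Set.indicator_of_notMem (fun h => hu ((hiff y).1 h).1) _).trans lintegral_zero
    have h1 := key (fun _ => 1) measurable_const
    have hmS : Measurable ((Set.Iio c).indicator fun u : ℝ =>
        ∫⁻ y, (firstReach n (c - u)).indicator (fun _ => 1) y ∂iidLaw (expMeasure r)) := by
      refine Measurable.indicator ?_ measurableSet_Iio
      have h2 : Measurable fun p : ℝ × (ℕ → ℝ) => (c - p.1, p.2) :=
        (measurable_const.sub measurable_fst).prodMk measurable_snd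
      have h3 : Measurable ({p : ℝ × (ℕ → ℝ) | p.2 ∈ firstReach n (c - p.1)}.indicator
          fun _ => (1 : ℝ≥0∞)) :=
        measurable_const.indicator ((measurableSet_firstReach n).preimage h2)
      exact h3.lintegral_prod_right' (ν := iidLaw (expMeasure r))
    rw [key g hg, h1, ← lintegral_mul_const _ hmS]
    refine lintegral_congr fun u => ?_
    by_cases hu : u < c
    · rw [Set.indicator_of_mem (show u ∈ Set.Iio c from hu),
        Set.indicator_of_mem (show u ∈ Set.Iio c from hu)]
      exact ih (sub_nonneg.2 hu.le)
    · rw [Set.indicator_of_notMem (show u ∉ Set.Iio c from hu),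
        Set.indicator_of_notMem (show u ∉ Set.Iio c from hu), zero_mul]

/-- A Poisson process seen from a fixed time `c` is again a Poisson process of the same rate. -/
lemma measurePreserving_residual {r : ℝ} (hr : 0 < r) {c : ℝ} (hc : 0 ≤ c) :
    MeasurePreserving (residual c) (iidLaw (expMeasure r)) (iidLaw (expMeasure r)) := by
  have := isProbabilityMeasure_expMeasure hr
  have hres : Measurable (residual c) :=
    Measurable.of_uncurry_left (f := residual) measurable_residual
  have hS : ∀ n, MeasurableSet (firstReach n c) := fun n =>
    measurableSet_firstReach n |>.preimage (measurable_const.prodMk measurable_id :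
      Measurable fun y : ℕ → ℝ => (c, y))
  have hsum : ∀ g : (ℕ → ℝ) → ℝ≥0∞, Measurable g →
      ∫⁻ y, g (residual c y) ∂iidLaw (expMeasure r)
        = (∑' n, iidLaw (expMeasure r) (firstReach n c))
          * ∫⁻ y, g y ∂iidLaw (expMeasure r) := fun g hg => by
    have hm : ∀ n, Measurable fun y : ℕ → ℝ =>
        (firstReach n c).indicator (fun y => g (consSeq (epoch y n - c) (dropSeq (n + 1) y))) y :=
      fun n => (hg.comp (measurable_consSeq.comp
        (((measurable_epoch n).sub_const c).prodMk (measurable_dropSeq (n + 1))))).indicator (hS n)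
    rw [← ENNReal.tsum_mul_right]
    simp_rw [← lintegral_indicator_firstReach hr _ hc hg]
    rw [← lintegral_tsum fun n => (hm n).aemeasurable]
    refine lintegral_congr_ae ?_
    filter_upwards [ae_tendsto_epoch hr] with y hy
    have hmem := mem_firstReach (c := c) (y := y) (hy.eventually_ge_atTop c).exists
    rw [tsum_eq_single (firstIndex c y), Set.indicator_of_mem hmem]
    · rfl
    · exact fun n hn => Set.indicator_of_notMem (fun h => hn (firstIndex_of_mem h).symm) _
  have h1 := hsum (fun _ => 1) measurable_const
  simp only [lintegral_one, measure_univ, mul_one] at h1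
  -- With `g = 1` in `hsum`, the sum of the probabilities is seen to be `1`.
  refine ⟨hres, Measure.ext fun s hs => ?_⟩
  rw [Measure.map_apply hres hs, ← lintegral_indicator_one (hs.preimage hres),
    ← lintegral_indicator_one hs]
  have := hsum (s.indicator 1) (measurable_one.indicator hs)
  rwa [← h1, one_mul] at this

/-- `gap s x k` is the time that the server stays idle before the arrival of the `k`-th successful
update, when `s` lists the service times and `x` the inter-arrival times of all updates. After the
first service, the system starts afresh with the residual inter-arrival times. -/
def gap : (ℕ → ℝ) → (ℕ → ℝ) → ℕ → ℝ
  | _, x, 0 => x 0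
  | s, x, k + 1 => gap (dropSeq 1 s) (residual (s 0) (dropSeq 1 x)) k

lemma measurable_gap : Measurable fun p : (ℕ → ℝ) × (ℕ → ℝ) => gap p.1 p.2 := by
  refine measurable_pi_lambda _ fun k => ?_
  induction k with
  | zero => exact (measurable_pi_apply 0).comp measurable_snd
  | succ k ih =>
    exact ih.comp (((measurable_dropSeq 1).comp measurable_fst).prodMk (measurable_residual.comp
      (((measurable_pi_apply 0).comp measurable_fst).prodMk
        ((measurable_dropSeq 1).comp measurable_snd))))

/-- Whatever the service times are, the idle periods are i.i.d. exponential random variables. -/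
lemma map_gap {r : ℝ} (hr : 0 < r) {s : ℕ → ℝ} (hs : ∀ k, 0 ≤ s k) :
    (iidLaw (expMeasure r)).map (gap s) = iidLaw (expMeasure r) := by
  have := isProbabilityMeasure_expMeasure hr
  have hg : ∀ s, Measurable (gap s) := fun s =>
    measurable_gap.comp (measurable_const.prodMk measurable_id)
  refine eq_iidLaw _ fun n t ht => ?_
  have hbox : ∀ n (t : ℕ → Set ℝ), (∀ i, MeasurableSet (t i)) →
      MeasurableSet ((Finset.range n : Set ℕ).pi t) := fun n t ht =>
    MeasurableSet.pi (Finset.range n).countable_toSet fun i _ => ht i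
  rw [Measure.map_apply (hg s) (hbox n t ht)]
  induction n generalizing s t with
  | zero => simp
  | succ n ih =>
    have hM := ((hbox (n + 1) t ht).preimage (hg s))
    have hM' := (hbox n (fun i => t (i + 1)) fun i => ht (i + 1)).preimage (hg (dropSeq 1 s))
    have hiff : ∀ u y, consSeq u y ∈ gap s ⁻¹' (Finset.range (n + 1) : Set ℕ).pi t ↔
        u ∈ t 0 ∧ residual (s 0) y ∈
          gap (dropSeq 1 s) ⁻¹' (Finset.range n : Set ℕ).pi fun i => t (i + 1) := fun u y => by
      simp only [Set.mem_preimage, Set.mem_pi, Finset.coe_range, Set.mem_Iio]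
      constructor
      · refine fun h => ⟨h 0 n.succ_pos, fun i hi => ?_⟩
        have := h (i + 1) (Nat.succ_lt_succ hi)
        rwa [gap, dropSeq_one_consSeq] at this
      · rintro ⟨h0, h1⟩ (_ | i) hi
        · exact h0
        · rw [gap, dropSeq_one_consSeq]
          exact h1 i (Nat.lt_of_succ_lt_succ hi)
    rw [← lintegral_indicator_one hM, lintegral_iidLaw _ (measurable_one.indicator hM),
      Finset.prod_range_succ', mul_comm,
      ← ih (s := dropSeq 1 s) (fun k => hs _) (fun i => t (i + 1)) fun i => ht (i + 1)]
    rw [← lintegral_indicator_one (ht 0), ← lintegral_mul_const _ (measurable_one.indicator (ht 0))]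
    refine lintegral_congr fun u => ?_
    by_cases hu : u ∈ t 0
    · rw [Set.indicator_of_mem hu, Pi.one_apply, one_mul, ← lintegral_indicator_one hM',
        ← (measurePreserving_residual hr (hs 0)).lintegral_comp (measurable_one.indicator hM')]
      refine lintegral_congr fun y => ?_
      by_cases hy : residual (s 0) y ∈
          gap (dropSeq 1 s) ⁻¹' (Finset.range n : Set ℕ).pi fun i => t (i + 1)
      · exact (Set.indicator_of_mem ((hiff u y).2 ⟨hu, hy⟩) _).trans
          (Set.indicator_of_mem hy (1 : (ℕ → ℝ) → ℝ≥0∞)).symm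
      · exact (Set.indicator_of_notMem (fun h => hy ((hiff u y).1 h).2) _).trans
          (Set.indicator_of_notMem hy _).symm
    · rw [Set.indicator_of_notMem hu, zero_mul]
      exact (lintegral_congr fun y =>
        Set.indicator_of_notMem (fun h => hu ((hiff u y).1 h).1) _).trans lintegral_zero

lemma sInf_lt_and_add {m i : ℕ} {p : ℕ → Prop} (h : ∃ n, i < n ∧ p (m + n)) :
    sInf {n | m + i < n ∧ p n} = m + sInf {n | i < n ∧ p (m + n)} := by
  refine le_antisymm (Nat.sInf_le ?_) ?_
  · have := Nat.sInf_mem (s := {n | i < n ∧ p (m + n)}) h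
    exact ⟨Nat.add_lt_add_left this.1 m, this.2⟩
  · obtain ⟨n, hn, hp⟩ := h
    have := Nat.sInf_mem (s := {n | m + i < n ∧ p n}) ⟨m + n, Nat.add_lt_add_left hn m, hp⟩
    obtain ⟨l, hl⟩ := Nat.exists_eq_add_of_le ((Nat.le_add_right m i).trans this.1.le)
    rw [hl] at this ⊢
    exact Nat.add_le_add_left (Nat.sInf_le (s := {n | i < n ∧ p (m + n)})
      ⟨Nat.lt_of_add_lt_add_left this.1, this.2⟩) m

lemma tendsto_epoch_residual {x : ℕ → ℝ} (hx : Tendsto (epoch x) atTop atTop) (c : ℝ) :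
    Tendsto (epoch (residual c (dropSeq 1 x))) atTop atTop := by
  have : ∀ m, epoch (residual c (dropSeq 1 x)) m
      = epoch x (m + (firstIndex c (dropSeq 1 x) + 1)) + (-(x 0) - c) := fun m => by
    rw [epoch_residual, show m + (firstIndex c (dropSeq 1 x) + 1)
      = 0 + 1 + (firstIndex c (dropSeq 1 x) + m) by ring, epoch_add_dropSeq, epoch_zero]
    ring
  rw [funext this]
  exact tendsto_atTop_add_const_right _ _ (hx.comp (tendsto_add_atTop_nat _))

/-- After the first service, the queue evolves like a queue that is idle initially and is fed by the
residual arrival process. -/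
lemma successfulIndex_succ_eq {s x : ℕ → ℝ} (hx : Tendsto (epoch x) atTop atTop) (k : ℕ) :
    successfulIndex (epoch x) s (k + 1) = firstIndex (s 0) (dropSeq 1 x) + 1
      + successfulIndex (epoch (residual (s 0) (dropSeq 1 x))) (dropSeq 1 s) k := by
  set N := firstIndex (s 0) (dropSeq 1 x) with hN
  have ha : ∀ m, epoch x (N + 1 + m)
      = epoch (residual (s 0) (dropSeq 1 x)) m + (x 0 + s 0) := fun m => by
    rw [epoch_residual, show N + 1 + m = 0 + 1 + (N + m) by ring, epoch_add_dropSeq, epoch_zero]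
    ring
  induction k with
  | zero =>
    simp only [successfulIndex, add_zero]
    have hset : ∀ n, (0 < n ∧ epoch x 0 + s 0 ≤ epoch x n)
        ↔ (1 + 0 ≤ n ∧ epoch x 0 + s 0 ≤ epoch x n) := fun n => by simp [Nat.succ_le_iff]
    have h1 : firstIndex (s 0) (dropSeq 1 x)
        = sInf {n | epoch x 0 + s 0 ≤ epoch x (n + 1)} := by
      have : ∀ n, epoch x (n + 1) = epoch x 0 + epoch (dropSeq 1 x) n := fun n => by
        rw [show n + 1 = 0 + 1 + n by ring, epoch_add_dropSeq]
      simp_rw [firstIndex, this, add_le_add_iff_left]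
    rw [hN, h1]
    have h2 : 1 ≤ sInf {n | 0 < n ∧ epoch x 0 + s 0 ≤ epoch x n} := by
      obtain ⟨n, hn⟩ := ((eventually_gt_atTop 0).and
        (hx.eventually_ge_atTop (epoch x 0 + s 0))).exists
      exact (Nat.sInf_mem (s := {n | 0 < n ∧ epoch x 0 + s 0 ≤ epoch x n}) ⟨n, hn⟩).1
    rw [← Nat.sInf_add h2]
    simp
  | succ k ih =>
    rw [successfulIndex, ih, successfulIndex]
    set i := successfulIndex (epoch (residual (s 0) (dropSeq 1 x))) (dropSeq 1 s) k
    have hs : s (k + 1) = dropSeq 1 s k := by simp [dropSeq, add_comm 1 k]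
    rw [sInf_lt_and_add (p := fun n => epoch x (N + 1 + i) + s (k + 1) ≤ epoch x n)]
    · congr 2
      ext n
      simp only [ha, hs, Set.mem_ofPred_eq]
      constructor <;> rintro ⟨h1, h2⟩ <;> exact ⟨h1, by linarith⟩
    · have h3 : Tendsto (fun n => epoch x (N + 1 + n)) atTop atTop :=
        hx.comp (tendsto_atTop_mono (fun n => Nat.le_add_left n _) tendsto_id)
      exact ((eventually_gt_atTop i).and (h3.eventually_ge_atTop _)).exists

lemma arrivalTime_succ_eq {s x : ℕ → ℝ} (hx : Tendsto (epoch x) atTop atTop) (k : ℕ) :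
    arrivalTime (epoch x) s (k + 1) = x 0 + s 0
      + arrivalTime (epoch (residual (s 0) (dropSeq 1 x))) (dropSeq 1 s) k := by
  rw [arrivalTime, successfulIndex_succ_eq hx, arrivalTime, epoch_residual,
    show ∀ a b : ℕ, a + 1 + b = 0 + 1 + (a + b) by intros; ring, epoch_add_dropSeq, epoch_zero]
  ring

lemma arrivalTime_eq_sum {s x : ℕ → ℝ} (hx : Tendsto (epoch x) atTop atTop) (k : ℕ) :
    arrivalTime (epoch x) s k
      = ∑ i ∈ Finset.range (k + 1), gap s x i + ∑ i ∈ Finset.range k, s i := by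
  induction k generalizing s x with
  | zero => simp [arrivalTime, successfulIndex, epoch_zero, gap]
  | succ k ih =>
    rw [arrivalTime_succ_eq hx, ih (tendsto_epoch_residual hx _), Finset.sum_range_succ' (gap s x),
      Finset.sum_range_succ' s]
    simp only [gap, dropSeq, add_comm 1]
    ring

/-! ### Averages over the events of a Poisson process -/

/-- The averages `R T / T` of a monotone function converge as soon as they converge along a
sequence of times whose successive ratios tend to `1`. -/
lemma tendsto_div_of_monotone_of_tendsto_ratio {R : ℝ → ℝ} (hR : Monotone R) (h0 : ∀ T, 0 ≤ R T)
    {u : ℕ → ℝ} (hu : Tendsto u atTop atTop)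
    (hratio : Tendsto (fun n => u (n + 1) / u n) atTop (𝓝 1)) {L : ℝ}
    (hL : Tendsto (fun n => R (u n) / u n) atTop (𝓝 L)) :
    Tendsto (fun T => R T / T) atTop (𝓝 L) := by
  have hL' := hL.comp (tendsto_add_atTop_nat 1)
  have hup : Tendsto (fun n => R (u (n + 1)) / u n) atTop (𝓝 L) := by
    have := hL'.mul hratio
    rw [mul_one] at this
    refine this.congr' ?_
    filter_upwards [(hu.comp (tendsto_add_atTop_nat 1)).eventually_gt_atTop 0] with n hn
    have : u (n + 1) ≠ 0 := ne_of_gt hn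
    simp only [Function.comp_apply]
    field_simp
  have hlow : Tendsto (fun n => R (u n) / u (n + 1)) atTop (𝓝 L) := by
    have := hL.mul (hratio.inv₀ one_ne_zero)
    rw [inv_one, mul_one] at this
    refine this.congr' ?_
    filter_upwards [hu.eventually_gt_atTop 0] with n hn
    have : u n ≠ 0 := ne_of_gt hn
    field_simp
  have hbetween : ∀ p : ℕ → Prop, (∀ᶠ n in atTop, p n) →
      ∀ᶠ T in atTop, ∃ n, p n ∧ 0 < u n ∧ 0 < u (n + 1) ∧ u n ≤ T ∧ T ≤ u (n + 1) := by
    intro p hp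
    obtain ⟨N, hN⟩ := eventually_atTop.1 (hp.and (hu.eventually_gt_atTop 0))
    filter_upwards [eventually_ge_atTop (u N)] with T hT
    have hex : ∃ m, T < u (N + m) :=
      ((hu.comp (tendsto_atTop_mono (fun m => Nat.le_add_left m N) tendsto_id)).eventually_gt_atTop
        T).exists
    classical
    have hm := Nat.find_spec hex
    have hmin : ∀ k < Nat.find hex, u (N + k) ≤ T := fun k hk => not_lt.1 (Nat.find_min hex hk)
    cases hcase : Nat.find hex with
    | zero => rw [hcase] at hm; exact absurd hT (not_le.2 (by simpa using hm))
    | succ k =>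
      rw [hcase] at hm hmin
      have h1 := hN (N + k) (Nat.le_add_right N k)
      exact ⟨N + k, h1.1, h1.2, (hN (N + k + 1) (by omega)).2, hmin k k.lt_succ_self, hm.le⟩
  refine tendsto_order.2 ⟨fun a ha => ?_, fun a ha => ?_⟩
  · filter_upwards [hbetween _ (hlow.eventually_const_lt ha)] with T ⟨n, h1, h2, h3, h4, h5⟩
    refine h1.trans_le ?_
    have hT : 0 < T := h2.trans_le h4
    have := hR h4
    exact div_le_div₀ (h0 T) this hT h5
  · filter_upwards [hbetween _ (hup.eventually_lt_const ha)] with T ⟨n, h1, h2, h3, h4, h5⟩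
    refine lt_of_le_of_lt ?_ h1
    exact div_le_div₀ (h0 _) (hR h5) h2 h4

lemma lintegral_sq_sub_mean_le {Ω : Type*} [MeasurableSpace Ω] {P : Measure Ω}
    [IsProbabilityMeasure P] {V : Ω → ℝ≥0∞} (hV : Measurable V) {A M : ℝ≥0∞} (hM : M ≠ ∞)
    (h1 : ∫⁻ ω, V ω ∂P = M) (h2 : ∫⁻ ω, V ω ^ 2 ∂P ≤ A + M ^ 2) :
    ∫⁻ ω, ENNReal.ofReal (((V ω).toReal - M.toReal) ^ 2) ∂P ≤ A := by
  have hae : ∀ᵐ ω ∂P, V ω < ∞ := ae_lt_top hV (h1 ▸ hM)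
  -- The square is expanded without subtraction, so that it can be integrated in `ℝ≥0∞`.
  have hpt : ∀ᵐ ω ∂P, ENNReal.ofReal (((V ω).toReal - M.toReal) ^ 2) + 2 * M * V ω
      = V ω ^ 2 + M ^ 2 := by
    filter_upwards [hae] with ω hω
    set x := (V ω).toReal with hx
    set m := M.toReal with hm
    have hx0 : 0 ≤ x := ENNReal.toReal_nonneg
    have hm0 : 0 ≤ m := ENNReal.toReal_nonneg
    rw [← ENNReal.ofReal_toReal hω.ne, ← ENNReal.ofReal_toReal hM, ← hx, ← hm,
      ← ENNReal.ofReal_pow hx0, ← ENNReal.ofReal_pow hm0, ← ENNReal.ofReal_add (by positivity)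
      (by positivity), ← ENNReal.ofReal_ofNat 2, ← ENNReal.ofReal_mul (by positivity),
      ← ENNReal.ofReal_mul (by positivity), ← ENNReal.ofReal_add (by positivity) (by positivity)]
    congr 1
    ring
  have hmeas : Measurable fun ω => ENNReal.ofReal (((V ω).toReal - M.toReal) ^ 2) := by fun_prop
  have h3 := lintegral_congr_ae hpt
  rw [lintegral_add_left hmeas, lintegral_const_mul _ hV, h1, lintegral_add_left (hV.pow_const 2),
    lintegral_const, measure_univ, mul_one] at h3
  have h4 : 2 * M * M ≠ ∞ := by finiteness
  refine (ENNReal.add_le_add_iff_right h4).1 ?_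
  rw [h3]
  calc _ ≤ A + M ^ 2 + M ^ 2 := by gcongr
    _ = _ := by ring

/-- The total of the values of `f` at the events, up to time `T`, of the point process with
inter-event times `z`. -/
def eventSum (f : ℝ → ℝ≥0∞) (z : ℕ → ℝ) (T : ℝ) : ℝ≥0∞ :=
  ∑' n, (Set.Iic T).indicator f (epoch z n)

lemma eventSum_mono (f : ℝ → ℝ≥0∞) (z : ℕ → ℝ) : Monotone (eventSum f z) := fun _ _ h =>
  ENNReal.tsum_le_tsum fun _ =>
    Set.indicator_le_indicator_of_subset (Set.Iic_subset_Iic.2 h) (fun _ => zero_le) _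

lemma measurable_eventSum {E : Type*} [MeasurableSpace E] {F : E → ℝ → ℝ≥0∞}
    (hF : Measurable (Function.uncurry F)) (T : ℝ) :
    Measurable fun p : E × (ℕ → ℝ) => eventSum (F p.1) p.2 T := by
  refine Measurable.tsum fun n => ?_
  have h1 : Measurable ({q : E × ℝ | q.2 ∈ Set.Iic T}.indicator (Function.uncurry F)) :=
    hF.indicator (measurable_snd measurableSet_Iic)
  have h2 : Measurable fun p : E × (ℕ → ℝ) => (p.1, epoch p.2 n) :=
    measurable_fst.prodMk ((measurable_epoch n).comp measurable_snd)
  exact h1.comp h2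

/-- Variance bound for the sum of a fixed function over the events of a Poisson process. -/
lemma lintegral_sq_eventSum_sub_le {r : ℝ} (hr : 0 < r) {f : ℝ → ℝ≥0∞} (hf : Measurable f)
    {T : ℝ} (hfin : ∫⁻ t in Set.Icc 0 T, f t ≠ ∞) :
    ∫⁻ z, ENNReal.ofReal (((eventSum f z T).toReal - r * (∫⁻ t in Set.Icc 0 T, f t).toReal) ^ 2)
        ∂iidLaw (expMeasure r)
      ≤ ENNReal.ofReal r * ∫⁻ t in Set.Icc 0 T, f t ^ 2 := by
  have := isProbabilityMeasure_expMeasure hr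
  have hfT : Measurable ((Set.Iic T).indicator f) := hf.indicator measurableSet_Iic
  have hres : ∀ g : ℝ → ℝ≥0∞, ∫⁻ t in Set.Ici 0, (Set.Iic T).indicator g t
      = ∫⁻ t in Set.Icc 0 T, g t := fun g => by
    rw [lintegral_indicator measurableSet_Iic, Measure.restrict_restrict measurableSet_Iic,
      Set.inter_comm, Set.Ici_inter_Iic]
  have hsq : ∀ t, (Set.Iic T).indicator f t ^ 2 = (Set.Iic T).indicator (fun t => f t ^ 2) t :=
    fun t => by by_cases ht : t ∈ Set.Iic T <;> simp [ht]
  have h1 := lintegral_tsum_epoch hr hfT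
  have h2 := lintegral_sq_tsum_epoch_le hr hfT
  simp_rw [hsq, hres] at h2
  rw [hres] at h1
  have hm : Measurable fun z => eventSum f z T :=
    Measurable.tsum fun n => hfT.comp (measurable_epoch n)
  have := lintegral_sq_sub_mean_le hm (ENNReal.mul_ne_top ENNReal.ofReal_ne_top hfin) h1 h2
  rwa [ENNReal.toReal_mul, ENNReal.toReal_ofReal hr.le] at this

lemma tendsto_succ_pow_four_ratio :
    Tendsto (fun n : ℕ => ((n + 1 : ℕ) + 1 : ℝ) ^ 4 / ((n : ℝ) + 1) ^ 4) atTop (𝓝 1) := by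
  have h : Tendsto (fun n : ℕ => (1 + 1 / ((n : ℝ) + 1)) ^ 4) atTop (𝓝 ((1 + 0) ^ 4)) :=
    (tendsto_one_div_add_atTop_nhds_zero_nat.const_add 1).pow 4
  simp only [add_zero, one_pow] at h
  refine h.congr fun n => ?_
  have : (n + 1 : ℝ) ≠ 0 := by positivity
  rw [← div_pow]
  congr 1
  push_cast
  field_simp

lemma tendsto_succ_pow_four_atTop :
    Tendsto (fun n : ℕ => ((n : ℝ) + 1) ^ 4) atTop atTop :=
  (tendsto_pow_atTop (by norm_num)).comp
    (tendsto_atTop_add_const_right _ 1 tendsto_natCast_atTop_atTop)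

/-- A random function `F w`, observed at the events of an independent Poisson process, has the
same average over the events as over time, provided that its square does not grow too fast. -/
lemma ae_tendsto_eventSum_div {E : Type*} [MeasurableSpace E] {Q : Measure E}
    [IsProbabilityMeasure Q] {r : ℝ} (hr : 0 < r) {F : E → ℝ → ℝ≥0∞}
    (hF : Measurable (Function.uncurry F)) {v : ℝ}
    (hfin : ∀ᵐ w ∂Q, ∀ T, ∫⁻ t in Set.Icc 0 T, F w t ≠ ∞)
    (hlim : ∀ᵐ w ∂Q, Tendsto (fun T => (∫⁻ t in Set.Icc 0 T, F w t).toReal / T) atTop (𝓝 v))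
    (hsq : ∀ᵐ w ∂Q, ∃ K : ℝ≥0∞, K ≠ ∞ ∧ ∀ n : ℕ,
      ∫⁻ t in Set.Icc 0 (((n : ℝ) + 1) ^ 4), F w t ^ 2 ≤ K * ENNReal.ofReal (((n : ℝ) + 1) ^ 6)) :
    ∀ᵐ p ∂Q.prod (iidLaw (expMeasure r)), (∀ T, eventSum (F p.1) p.2 T ≠ ∞) ∧
      Tendsto (fun T => (eventSum (F p.1) p.2 T).toReal / T) atTop (𝓝 (r * v)) := by
  have := isProbabilityMeasure_expMeasure hr
  -- Along these times, variances of order `T ^ (3 / 2)` are summable relative to `T ^ 2`, and the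
  -- ratio of successive times still tends to `1`.
  set T : ℕ → ℝ := fun n => ((n : ℝ) + 1) ^ 4 with hT
  have hTpos : ∀ n, 0 < T n := fun n => by simp only [hT]; positivity
  set m : E → ℕ → ℝ := fun w n => (∫⁻ t in Set.Icc 0 (T n), F w t).toReal with hm
  have hFw : ∀ w, Measurable (F w) := fun w => Measurable.of_uncurry_left hF
  have hmm : ∀ n, Measurable fun w => m w n := fun n =>
    (hF.lintegral_prod_right' (ν := volume.restrict (Set.Icc 0 (T n)))).ennreal_toReal
  -- Convergence is deduced from the finiteness of `∑ D p n`, because this event is jointly measurable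
  -- in the path and the Poisson process, as is needed for Fubini's theorem.
  set D : E × (ℕ → ℝ) → ℕ → ℝ≥0∞ := fun p n => ENNReal.ofReal
    (((eventSum (F p.1) p.2 (T n)).toReal - r * m p.1 n) ^ 2) * ENNReal.ofReal ((T n ^ 2)⁻¹) with hD
  have hDm : ∀ n, Measurable fun p => D p n := fun n => by
    have h1 := (measurable_eventSum hF (T n)).ennreal_toReal
    have h2 : Measurable fun p : E × (ℕ → ℝ) => m p.1 n := (hmm n).comp measurable_fst
    exact ((h1.sub (h2.const_mul r)).pow_const 2).ennreal_ofReal.mul_const _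
  have hDsum : Measurable fun p => ∑' n, D p n := Measurable.tsum hDm
  -- Conditionally on `w`, the expected total of the squared relative errors is finite.
  have hDfin : ∀ᵐ p ∂Q.prod (iidLaw (expMeasure r)), ∑' n, D p n < ∞ := by
    refine (Measure.ae_prod_iff_ae_ae (measurableSet_lt hDsum measurable_const)).2 ?_
    filter_upwards [hfin, hsq] with w hw ⟨K, hK, hwsq⟩
    refine ae_lt_top (hDsum.comp measurable_prodMk_left) ?_
    have hDw : ∀ n, Measurable fun z => D (w, z) n := fun n => (hDm n).comp measurable_prodMk_left
    rw [lintegral_tsum fun n => (hDw n).aemeasurable]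
    have hterm : ∀ n : ℕ, ∫⁻ z, D (w, z) n ∂iidLaw (expMeasure r)
        ≤ ENNReal.ofReal r * K * ENNReal.ofReal ((((n : ℝ) + 1) ^ 2)⁻¹) := fun n => by
      simp only [hD]
      rw [lintegral_mul_const' _ _ ENNReal.ofReal_ne_top]
      calc _ ≤ (ENNReal.ofReal r * (K * ENNReal.ofReal (((n : ℝ) + 1) ^ 6)))
            * ENNReal.ofReal ((T n ^ 2)⁻¹) := by
            gcongr
            exact (lintegral_sq_eventSum_sub_le hr (hFw w) (hw (T n))).trans
              (by gcongr; exact hwsq n)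
        _ = ENNReal.ofReal r * K * (ENNReal.ofReal (((n : ℝ) + 1) ^ 6)
            * ENNReal.ofReal ((T n ^ 2)⁻¹)) := by ring
        _ = _ := by
            rw [← ENNReal.ofReal_mul (by positivity)]
            congr 2
            simp only [hT]
            field_simp
    refine ne_top_of_le_ne_top ?_ (ENNReal.tsum_le_tsum hterm)
    rw [ENNReal.tsum_mul_left]
    refine ENNReal.mul_ne_top (ENNReal.mul_ne_top ENNReal.ofReal_ne_top hK) ?_
    have hs : Summable fun n : ℕ => (((n : ℝ) + 1) ^ 2)⁻¹ := by
      have := (summable_nat_add_iff 1).2 (Real.summable_nat_pow_inv.2 one_lt_two)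
      simpa using this
    rw [← ENNReal.ofReal_tsum_of_nonneg (fun n => by positivity) hs]
    exact ENNReal.ofReal_ne_top
  have hVfin : ∀ᵐ p ∂Q.prod (iidLaw (expMeasure r)), ∀ n, eventSum (F p.1) p.2 (T n) < ∞ := by
    rw [ae_all_iff]
    intro n
    refine (Measure.ae_prod_iff_ae_ae
      (measurableSet_lt (measurable_eventSum hF (T n)) measurable_const)).2 ?_
    filter_upwards [hfin] with w hw
    refine ae_lt_top ((measurable_eventSum hF (T n)).comp measurable_prodMk_left) ?_
    have h := lintegral_tsum_epoch hr ((hFw w).indicator (measurableSet_Iic (a := T n)))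
    simp only [eventSum, h]
    rw [lintegral_indicator measurableSet_Iic, Measure.restrict_restrict measurableSet_Iic,
      Set.inter_comm, Set.Ici_inter_Iic]
    exact ENNReal.mul_ne_top ENNReal.ofReal_ne_top (hw (T n))
  have hlim' : ∀ᵐ p ∂Q.prod (iidLaw (expMeasure r)),
      Tendsto (fun T => (∫⁻ t in Set.Icc 0 T, F p.1 t).toReal / T) atTop (𝓝 v) :=
    Measure.quasiMeasurePreserving_fst.ae hlim
  filter_upwards [hDfin, hVfin, hlim'] with p hp1 hp2 hp3
  have hTtop : Tendsto T atTop atTop := tendsto_succ_pow_four_atTop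
  have hV : ∀ t, eventSum (F p.1) p.2 t ≠ ∞ := fun t => by
    obtain ⟨n, hn⟩ := (hTtop.eventually_ge_atTop t).exists
    exact ne_top_of_le_ne_top (hp2 n).ne (eventSum_mono _ _ hn)
  refine ⟨hV, tendsto_div_of_monotone_of_tendsto_ratio
    (fun a b hab => ENNReal.toReal_mono (hV b) (eventSum_mono _ _ hab))
    (fun _ => ENNReal.toReal_nonneg) hTtop tendsto_succ_pow_four_ratio ?_⟩
  have h1 : Tendsto (fun n => D p n) atTop (𝓝 0) := by
    rw [← Nat.cofinite_eq_atTop]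
    exact ENNReal.tendsto_cofinite_zero_of_tsum_ne_top hp1.ne
  have h2 : Tendsto (fun n => ((eventSum (F p.1) p.2 (T n)).toReal / T n - r * (m p.1 n / T n)) ^ 2)
      atTop (𝓝 0) := by
    have := (ENNReal.tendsto_toReal ENNReal.zero_ne_top).comp h1
    rw [ENNReal.toReal_zero] at this
    refine this.congr fun n => ?_
    have hpos := (hTpos n).ne'
    simp only [Function.comp_apply, hD]
    rw [ENNReal.toReal_mul, ENNReal.toReal_ofReal (sq_nonneg _),
      ENNReal.toReal_ofReal (by positivity)]
    field_simp
  have h3 : Tendsto (fun n => (eventSum (F p.1) p.2 (T n)).toReal / T n - r * (m p.1 n / T n))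
      atTop (𝓝 0) := by
    have := h2.sqrt
    simp only [Real.sqrt_sq_eq_abs, Real.sqrt_zero] at this
    exact (tendsto_zero_iff_abs_tendsto_zero _).2 this
  have h4 := h3.add ((hp3.comp hTtop).const_mul r)
  rw [zero_add] at h4
  refine h4.congr fun n => ?_
  simp [hm]

/-! ### The time average of the age along a path -/

/-- The service completion times, when `p.1` lists the service times and `p.2` the idle periods. -/
def completionTime (p : (ℕ → ℝ) × (ℕ → ℝ)) (k : ℕ) : ℝ := epoch (fun i => p.2 i + p.1 i) k

/-- The time from the arrival of the `k`-th successful update to the completion of the next one: the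
peak that the age reaches just before this completion. -/
def peakAge (p : (ℕ → ℝ) × (ℕ → ℝ)) (k : ℕ) : ℝ := p.1 k + p.2 (k + 1) + p.1 (k + 1)

/-- The age at time `t` of the update most recently received, as a function of the service times
`p.1` and the idle periods `p.2`. It is set to `0` before the first completion. -/
def cycleAge (p : (ℕ → ℝ) × (ℕ → ℝ)) (t : ℝ) : ℝ≥0∞ :=
  ∑' k, (Set.Ico (completionTime p k) (completionTime p (k + 1))).indicator
    (fun t => ENNReal.ofReal (t - completionTime p k + p.1 k)) t

lemma measurable_cycleAge : Measurable (Function.uncurry cycleAge) := by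
  have hd : ∀ k, Measurable fun q : ((ℕ → ℝ) × (ℕ → ℝ)) × ℝ => completionTime q.1 k := fun k => by
    refine (measurable_epoch k).comp (measurable_pi_lambda _ fun i => ?_)
    fun_prop
  refine Measurable.tsum fun k => ?_
  have hS : MeasurableSet {q : ((ℕ → ℝ) × (ℕ → ℝ)) × ℝ |
      completionTime q.1 k ≤ q.2 ∧ q.2 < completionTime q.1 (k + 1)} :=
    (measurableSet_le (hd k) measurable_snd).inter (measurableSet_lt measurable_snd (hd (k + 1)))
  have hf : Measurable fun q : ((ℕ → ℝ) × (ℕ → ℝ)) × ℝ =>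
      ENNReal.ofReal (q.2 - completionTime q.1 k + q.1.1 k) := by
    have := hd k
    fun_prop
  exact hf.indicator hS

lemma completionTime_succ (p : (ℕ → ℝ) × (ℕ → ℝ)) (k : ℕ) :
    completionTime p (k + 1) = completionTime p k + (p.2 (k + 1) + p.1 (k + 1)) :=
  epoch_succ _ k

lemma exists_forall_le_of_tendsto {u : ℕ → ℝ} {l : ℝ} (h : Tendsto u atTop (𝓝 l)) :
    ∃ C, 0 < C ∧ ∀ n, u n ≤ C := by
  obtain ⟨C, hC⟩ := h.bddAbove_range
  exact ⟨max C 1, by positivity, fun n => (hC ⟨n, rfl⟩).trans (le_max_left _ _)⟩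

section Path

variable {p : (ℕ → ℝ) × (ℕ → ℝ)}

lemma monotone_completionTime (hs : ∀ k, 0 ≤ p.1 k) (hj : ∀ k, 0 ≤ p.2 k) :
    Monotone (completionTime p) := monotone_nat_of_le_succ fun k => by
  have := hs (k + 1)
  have := hj (k + 1)
  rw [completionTime_succ]
  linarith

lemma completionTime_zero_nonneg (hs : ∀ k, 0 ≤ p.1 k) (hj : ∀ k, 0 ≤ p.2 k) :
    0 ≤ completionTime p 0 := by
  rw [completionTime, epoch_zero]
  exact add_nonneg (hj 0) (hs 0)

lemma cycleAge_of_mem (hs : ∀ k, 0 ≤ p.1 k) (hj : ∀ k, 0 ≤ p.2 k) {k : ℕ} {t : ℝ}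
    (ht : t ∈ Set.Ico (completionTime p k) (completionTime p (k + 1))) :
    cycleAge p t = ENNReal.ofReal (t - completionTime p k + p.1 k) := by
  have hmono := monotone_completionTime hs hj
  rw [cycleAge, tsum_eq_single k, Set.indicator_of_mem ht]
  intro l hl
  refine Set.indicator_of_notMem (fun hl' => ?_) _
  rcases lt_or_gt_of_ne hl with h | h
  · exact (hl'.2.trans_le (hmono (Nat.succ_le_of_lt h))).not_ge ht.1
  · exact (ht.2.trans_le (hmono (Nat.succ_le_of_lt h))).not_ge hl'.1

lemma lintegral_cycle (hs : ∀ k, 0 ≤ p.1 k) (hj : ∀ k, 0 ≤ p.2 k) (k : ℕ) :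
    ∫⁻ t in Set.Ico (completionTime p k) (completionTime p (k + 1)),
        ENNReal.ofReal (t - completionTime p k + p.1 k)
      = ENNReal.ofReal ((peakAge p k ^ 2 - p.1 k ^ 2) / 2) := by
  have hle := monotone_completionTime hs hj k.le_succ
  rw [← ofReal_integral_eq_lintegral_ofReal]
  · congr 1
    rw [integral_Ico_eq_integral_Ioc, ← intervalIntegral.integral_of_le hle]
    have : ∀ t, t - completionTime p k + p.1 k = t - (completionTime p k - p.1 k) := fun t => by
      ring
    simp_rw [this]
    rw [intervalIntegral.integral_comp_sub_right (fun t => t), integral_id, completionTime_succ,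
      peakAge]
    ring
  · refine IntegrableOn.mono_set ?_ Set.Ico_subset_Icc_self
    exact Continuous.integrableOn_Icc (by fun_prop)
  · filter_upwards [ae_restrict_mem measurableSet_Ico] with t ht
    exact add_nonneg (sub_nonneg.2 ht.1) (hs k)

lemma lintegral_cycleAge_completionTime (hs : ∀ k, 0 ≤ p.1 k) (hj : ∀ k, 0 ≤ p.2 k) (n : ℕ) :
    ∫⁻ t in Set.Icc 0 (completionTime p n), cycleAge p t
      = ENNReal.ofReal (∑ k ∈ Finset.range n, (peakAge p k ^ 2 - p.1 k ^ 2) / 2) := by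
  have hmono := monotone_completionTime hs hj
  have h0 := completionTime_zero_nonneg hs hj
  have hm : ∀ k, Measurable fun t => ENNReal.ofReal (t - completionTime p k + p.1 k) := fun k => by
    fun_prop
  have hnn : ∀ k, 0 ≤ (peakAge p k ^ 2 - p.1 k ^ 2) / 2 := fun k => by
    have := hs k
    have h1 : p.1 k ≤ peakAge p k := by
      have := hs (k + 1)
      have := hj (k + 1)
      rw [peakAge]; linarith
    have : p.1 k ^ 2 ≤ peakAge p k ^ 2 := by gcongr
    linarith
  simp only [cycleAge]
  rw [lintegral_tsum fun k => ((hm k).indicator measurableSet_Ico).aemeasurable,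
    tsum_eq_sum (s := Finset.range n), ENNReal.ofReal_sum_of_nonneg fun k _ => hnn k]
  · refine Finset.sum_congr rfl fun k hk => ?_
    rw [lintegral_indicator measurableSet_Ico, Measure.restrict_restrict measurableSet_Ico,
      Set.inter_eq_left.2, lintegral_cycle hs hj]
    exact fun t ht => ⟨(h0.trans (hmono k.zero_le)).trans ht.1,
      ht.2.le.trans (hmono (Nat.succ_le_of_lt (Finset.mem_range.1 hk)))⟩
  · intro k hk
    rw [lintegral_indicator measurableSet_Ico, Measure.restrict_restrict measurableSet_Ico]
    refine setLIntegral_measure_zero _ _ (measure_mono_null (t := {completionTime p n}) ?_ ?_)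
    · intro t ht
      have hnk : n ≤ k := not_lt.1 fun h => hk (Finset.mem_range.2 h)
      exact le_antisymm ht.2.2 ((hmono hnk).trans ht.1.1)
    · exact Real.volume_singleton

lemma tendsto_completionTime_div {a b : ℝ}
    (hS : Tendsto (fun n : ℕ => (∑ i ∈ Finset.range n, p.1 i) / n) atTop (𝓝 a))
    (hJ : Tendsto (fun n : ℕ => (∑ i ∈ Finset.range n, p.2 i) / n) atTop (𝓝 b)) :
    Tendsto (fun n : ℕ => completionTime p n / ((n : ℝ) + 1)) atTop (𝓝 (a + b)) := by
  refine ((hS.add hJ).comp (tendsto_add_atTop_nat 1)).congr fun n => ?_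
  simp only [Function.comp_apply, completionTime, epoch, Finset.sum_add_distrib]
  push_cast
  ring

lemma tendsto_completionTime {y : ℝ} (hy : 0 < y)
    (h : Tendsto (fun n : ℕ => completionTime p n / ((n : ℝ) + 1)) atTop (𝓝 y)) :
    Tendsto (completionTime p) atTop atTop := by
  have h1 : Tendsto (fun n : ℕ => (n : ℝ) + 1) atTop atTop :=
    tendsto_atTop_add_const_right _ 1 tendsto_natCast_atTop_atTop
  refine (h.pos_mul_atTop hy h1).congr fun n => ?_
  have : (n : ℝ) + 1 ≠ 0 := by positivity
  field_simp

lemma tendsto_completionTime_ratio {y : ℝ} (hy : 0 < y)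
    (h : Tendsto (fun n : ℕ => completionTime p n / ((n : ℝ) + 1)) atTop (𝓝 y)) :
    Tendsto (fun n => completionTime p (n + 1) / completionTime p n) atTop (𝓝 1) := by
  have h1 := (h.comp (tendsto_add_atTop_nat 1)).div h hy.ne'
  have h2 : Tendsto (fun n : ℕ => 1 + 1 / ((n : ℝ) + 1)) atTop (𝓝 (1 + 0)) :=
    tendsto_one_div_add_atTop_nhds_zero_nat.const_add 1
  have h3 := h1.mul h2
  rw [div_self hy.ne', add_zero, one_mul] at h3
  refine h3.congr' ?_
  filter_upwards [(tendsto_completionTime hy h).eventually_gt_atTop 0] with n hn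
  have : (n : ℝ) + 1 ≠ 0 := by positivity
  have : (n : ℝ) + 1 + 1 ≠ 0 := by positivity
  simp only [Pi.div_apply, Function.comp_apply]
  push_cast
  field_simp

lemma lintegral_cycleAge_ne_top (hs : ∀ k, 0 ≤ p.1 k) (hj : ∀ k, 0 ≤ p.2 k)
    (hd : Tendsto (completionTime p) atTop atTop) (T : ℝ) :
    ∫⁻ t in Set.Icc 0 T, cycleAge p t ≠ ∞ := by
  obtain ⟨n, hn⟩ := (hd.eventually_ge_atTop T).exists
  refine ne_top_of_le_ne_top ?_ (lintegral_mono_set (Set.Icc_subset_Icc_right hn))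
  rw [lintegral_cycleAge_completionTime hs hj]
  exact ENNReal.ofReal_ne_top

/-- The time average of the age: the area under the age curve over a cycle, divided by the length of
the cycle. -/
lemma tendsto_lintegral_cycleAge_div (hs : ∀ k, 0 ≤ p.1 k) (hj : ∀ k, 0 ≤ p.2 k) {y c l : ℝ}
    (hy : 0 < y)
    (hd : Tendsto (fun n : ℕ => completionTime p n / ((n : ℝ) + 1)) atTop (𝓝 y))
    (hS2 : Tendsto (fun n : ℕ => (∑ i ∈ Finset.range n, p.1 i ^ 2) / n) atTop (𝓝 c))
    (hL2 : Tendsto (fun n : ℕ => (∑ i ∈ Finset.range n, peakAge p i ^ 2) / n) atTop (𝓝 l)) :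
    Tendsto (fun T => (∫⁻ t in Set.Icc 0 T, cycleAge p t).toReal / T) atTop
      (𝓝 ((l - c) / 2 / y)) := by
  have htop := tendsto_completionTime hy hd
  have hfin := lintegral_cycleAge_ne_top hs hj htop
  have hm : Monotone fun T => ∫⁻ t in Set.Icc 0 T, cycleAge p t := fun a b hab =>
    lintegral_mono_set (Set.Icc_subset_Icc_right hab)
  refine tendsto_div_of_monotone_of_tendsto_ratio
    (fun a b hab => ENNReal.toReal_mono (hfin b) (hm hab)) (fun _ => ENNReal.toReal_nonneg)
    htop (tendsto_completionTime_ratio hy hd) ?_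
  have h2 : Tendsto (fun n : ℕ => (n : ℝ) / (n + 1)) atTop (𝓝 1) := tendsto_natCast_div_add_atTop 1
  have h3 := ((((hL2.sub hS2).div_const 2).mul h2).div hd hy.ne')
  rw [mul_one] at h3
  refine h3.congr' ?_
  filter_upwards [htop.eventually_gt_atTop 0, eventually_gt_atTop 0] with n hn hn0
  have hn1 : (n : ℝ) + 1 ≠ 0 := by positivity
  have hn2 : (n : ℝ) ≠ 0 := by positivity
  rw [lintegral_cycleAge_completionTime hs hj, ENNReal.toReal_ofReal, ← Finset.sum_div,
    Finset.sum_sub_distrib]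
  · simp only [Pi.div_apply]
    field_simp
  · refine Finset.sum_nonneg fun k _ => ?_
    have := hs k
    have h1 : p.1 k ≤ peakAge p k := by
      have := hs (k + 1)
      have := hj (k + 1)
      rw [peakAge]; linarith
    have : p.1 k ^ 2 ≤ peakAge p k ^ 2 := by gcongr
    linarith

/-- Since the squares of the peaks have a finite average, the age up to time `T` is at most of
order `√T`. Together with the linear growth of its integral, this bounds the integral of its
square. -/
lemma exists_lintegral_cycleAge_sq_le (hs : ∀ k, 0 ≤ p.1 k) (hj : ∀ k, 0 ≤ p.2 k) {y c l : ℝ}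
    (hy : 0 < y)
    (hd : Tendsto (fun n : ℕ => completionTime p n / ((n : ℝ) + 1)) atTop (𝓝 y))
    (hS2 : Tendsto (fun n : ℕ => (∑ i ∈ Finset.range n, p.1 i ^ 2) / n) atTop (𝓝 c))
    (hL2 : Tendsto (fun n : ℕ => (∑ i ∈ Finset.range n, peakAge p i ^ 2) / n) atTop (𝓝 l)) :
    ∃ K : ℝ≥0∞, K ≠ ∞ ∧ ∀ n : ℕ, ∫⁻ t in Set.Icc 0 (((n : ℝ) + 1) ^ 4), cycleAge p t ^ 2
      ≤ K * ENNReal.ofReal (((n : ℝ) + 1) ^ 6) := by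
  have hmono := monotone_completionTime hs hj
  have htop := tendsto_completionTime hy hd
  have hfin := lintegral_cycleAge_ne_top hs hj htop
  obtain ⟨A, hA, hA'⟩ := exists_forall_le_of_tendsto
    ((tendsto_lintegral_cycleAge_div hs hj hy hd hS2 hL2).comp tendsto_succ_pow_four_atTop)
  obtain ⟨B, hB, hB'⟩ := exists_forall_le_of_tendsto hL2
  -- `A` bounds the averages of the age, `B` those of the squared peaks; the completion time `k`
  -- exceeds `(k + 1) y / 2` from `N` on, so that only `O(T)` cycles begin before time `T`.
  obtain ⟨N, hN⟩ := eventually_atTop.1 (hd.eventually_const_lt (half_lt_self hy))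
  have hk : ∀ k : ℕ, (k : ℝ) + 1 ≤ 2 / y * completionTime p k + (N + 1) := fun k => by
    have hdk : 0 ≤ completionTime p k := (completionTime_zero_nonneg hs hj).trans (hmono k.zero_le)
    rcases le_total N k with h | h
    · have h1 := hN k h
      have hk1 : (0 : ℝ) < k + 1 := by positivity
      rw [lt_div_iff₀ hk1] at h1
      have h2 : (k : ℝ) + 1 ≤ 2 / y * completionTime p k := by
        rw [div_mul_eq_mul_div, le_div_iff₀ hy]; linarith
      have : (0 : ℝ) ≤ N := by positivity
      linarith
    · have : (k : ℝ) ≤ N := by exact_mod_cast h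
      have : 0 ≤ 2 / y * completionTime p k := by positivity
      linarith
  have hpeak : ∀ k : ℕ, peakAge p k ^ 2 ≤ B * (k + 1) := fun k => by
    have h1 := hB' (k + 1)
    have hk1 : (0 : ℝ) < (k + 1 : ℕ) := by positivity
    rw [div_le_iff₀ hk1] at h1
    refine le_trans ?_ (h1.trans_eq (by push_cast; ring))
    exact Finset.single_le_sum (f := fun i => peakAge p i ^ 2) (fun i _ => sq_nonneg _)
      (Finset.self_mem_range_succ k)
  set C := B * (2 / y + (N + 1)) with hC
  have hCpos : 0 < C := by positivity
  have hbound : ∀ n : ℕ, ∀ t ∈ Set.Icc 0 (((n : ℝ) + 1) ^ 4),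
      cycleAge p t ≤ ENNReal.ofReal (√C * ((n : ℝ) + 1) ^ 2) := fun n t ht => by
    by_cases hex : ∃ k, t ∈ Set.Ico (completionTime p k) (completionTime p (k + 1))
    · obtain ⟨k, hkt⟩ := hex
      rw [cycleAge_of_mem hs hj hkt]
      refine ENNReal.ofReal_le_ofReal ?_
      have h1 : t - completionTime p k + p.1 k ≤ peakAge p k := by
        have := hkt.2.le
        rw [completionTime_succ] at this
        rw [peakAge]; linarith
      refine h1.trans ?_
      have h2 : peakAge p k ^ 2 ≤ C * (((n : ℝ) + 1) ^ 2) ^ 2 := by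
        have hn1 : (1 : ℝ) ≤ ((n : ℝ) + 1) ^ 4 := one_le_pow₀ (by linarith [n.cast_nonneg (α := ℝ)])
        have h3 : completionTime p k ≤ ((n : ℝ) + 1) ^ 4 := hkt.1.trans ht.2
        calc peakAge p k ^ 2 ≤ B * (k + 1) := hpeak k
          _ ≤ B * (2 / y * completionTime p k + (N + 1)) := mul_le_mul_of_nonneg_left (hk k) hB.le
          _ ≤ B * (2 / y * ((n : ℝ) + 1) ^ 4 + (N + 1) * ((n : ℝ) + 1) ^ 4) := by
              gcongr
              exact le_mul_of_one_le_right (by positivity) hn1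
          _ = _ := by rw [hC]; ring
      calc peakAge p k ≤ √(C * (((n : ℝ) + 1) ^ 2) ^ 2) := Real.le_sqrt_of_sq_le h2
        _ = _ := by rw [Real.sqrt_mul hCpos.le, Real.sqrt_sq (by positivity)]
    · have : cycleAge p t = 0 := by
        simp only [cycleAge, ENNReal.tsum_eq_zero]
        exact fun k => Set.indicator_of_notMem (fun h => hex ⟨k, h⟩) _
      rw [this]; exact zero_le
  refine ⟨ENNReal.ofReal (√C * A), ENNReal.ofReal_ne_top, fun n => ?_⟩
  calc ∫⁻ t in Set.Icc 0 (((n : ℝ) + 1) ^ 4), cycleAge p t ^ 2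
      ≤ ∫⁻ t in Set.Icc 0 (((n : ℝ) + 1) ^ 4),
          ENNReal.ofReal (√C * ((n : ℝ) + 1) ^ 2) * cycleAge p t := by
        refine setLIntegral_mono' measurableSet_Icc fun t ht => ?_
        rw [sq]
        gcongr
        exact hbound n t ht
    _ = ENNReal.ofReal (√C * ((n : ℝ) + 1) ^ 2)
          * ∫⁻ t in Set.Icc 0 (((n : ℝ) + 1) ^ 4), cycleAge p t :=
        lintegral_const_mul' _ _ ENNReal.ofReal_ne_top
    _ ≤ ENNReal.ofReal (√C * ((n : ℝ) + 1) ^ 2) * ENNReal.ofReal (A * ((n : ℝ) + 1) ^ 4) := by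
        gcongr
        rw [← ENNReal.ofReal_toReal (hfin (((n : ℝ) + 1) ^ 4))]
        refine ENNReal.ofReal_le_ofReal ?_
        have := hA' n
        rwa [Function.comp_apply, div_le_iff₀ (by positivity)] at this
    _ = _ := by
        rw [← ENNReal.ofReal_mul (by positivity), ← ENNReal.ofReal_mul (by positivity)]
        congr 1
        ring

end Path

/-! ### Laws of large numbers for the cycles -/

lemma ae_tendsto_average_iidLaw (ρ : Measure ℝ) [IsProbabilityMeasure ρ] {φ : ℝ → ℝ}
    (hφ : Measurable φ) (hint : Integrable φ ρ) :
    ∀ᵐ x ∂iidLaw ρ, Tendsto (fun n : ℕ => (∑ i ∈ Finset.range n, φ (x i)) / n) atTop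
      (𝓝 (∫ u, φ u ∂ρ)) := by
  have hev : ∀ i : ℕ, MeasurePreserving (fun x : ℕ → ℝ => x i) (iidLaw ρ) ρ := fun i =>
    measurePreserving_eval_infinitePi (fun _ => ρ) i
  have h := strong_law_ae_real (μ := iidLaw ρ) (fun i (x : ℕ → ℝ) => φ (x i))
    ((hev 0).integrable_comp_of_integrable hint) ?_ ?_
  · have h1 : ∫ x : ℕ → ℝ, φ (x 0) ∂iidLaw ρ = ∫ u, φ u ∂ρ := by
      have := integral_map (hev 0).measurable.aemeasurable
        (hφ.aestronglyMeasurable (μ := (iidLaw ρ).map fun x => x 0))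
      rw [(hev 0).map_eq] at this
      exact this.symm
    rwa [h1] at h
  · intro i j hij
    exact (iIndepFun_infinitePi (P := fun _ : ℕ => ρ) (X := fun _ => φ) fun _ => hφ).indepFun hij
  · intro i
    refine ⟨(hφ.comp (measurable_pi_apply i)).aemeasurable,
      (hφ.comp (measurable_pi_apply 0)).aemeasurable, ?_⟩
    have : ∀ i, (iidLaw ρ).map (fun x => φ (x i)) = ρ.map φ := fun i => by
      rw [← (hev i).map_eq, Measure.map_map hφ (measurable_pi_apply i), (hev i).map_eq]
      rfl
    rw [this, this]

/-- The strong law of large numbers for nonnegative, identically distributed random variables, of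
which any two that are not neighbours are independent: it holds along the even and along the odd
indices. -/
lemma ae_tendsto_average_of_indep_apart {Ω : Type*} [MeasurableSpace Ω] {P : Measure Ω}
    {W : ℕ → Ω → ℝ} (h0 : ∀ i ω, 0 ≤ W i ω) (hint : Integrable (W 0) P)
    (hident : ∀ i, IdentDistrib (W i) (W 0) P P)
    (hindep : ∀ i j, i + 2 ≤ j → IndepFun (W i) (W j) P) :
    ∀ᵐ ω ∂P, Tendsto (fun n : ℕ => (∑ i ∈ Finset.range n, W i ω) / n) atTop
      (𝓝 (∫ ω, W 0 ω ∂P)) := by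
  have hsub : ∀ e : ℕ, ∀ᵐ ω ∂P, Tendsto
      (fun n : ℕ => (∑ i ∈ Finset.range n, W (2 * i + e) ω) / n) atTop
      (𝓝 (∫ ω, W 0 ω ∂P)) := fun e => by
    have h := strong_law_ae_real (μ := P) (fun i => W (2 * i + e))
      ((hident _).integrable_iff.2 hint) ?_ fun i => (hident _).trans (hident _).symm
    · rwa [(hident (2 * 0 + e)).integral_eq] at h
    · intro i j hij
      rcases lt_or_gt_of_ne hij with h | h
      · exact hindep _ _ (by omega)
      · exact (hindep _ _ (by omega)).symm
  filter_upwards [hsub 0, hsub 1] with ω he ho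
  have hmono : Monotone fun T : ℝ => ∑ i ∈ Finset.range ⌊T⌋₊, W i ω := fun a b hab =>
    Finset.sum_le_sum_of_subset_of_nonneg (Finset.range_mono (Nat.floor_le_floor hab))
      fun i _ _ => h0 i ω
  have hsum : ∀ n : ℕ, ∑ i ∈ Finset.range (2 * n), W i ω
      = ∑ i ∈ Finset.range n, W (2 * i + 0) ω + ∑ i ∈ Finset.range n, W (2 * i + 1) ω := fun n => by
    induction n with
    | zero => simp
    | succ n ih =>
      rw [show 2 * (n + 1) = 2 * n + 1 + 1 by ring, Finset.sum_range_succ, Finset.sum_range_succ,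
        ih, Finset.sum_range_succ, Finset.sum_range_succ]
      simp only [add_zero]
      ring
  have htop : Tendsto (fun n : ℕ => ((2 * n : ℕ) : ℝ)) atTop atTop :=
    tendsto_natCast_atTop_atTop.comp (tendsto_id.const_mul_atTop' two_pos)
  have key := tendsto_div_of_monotone_of_tendsto_ratio hmono
    (fun T => Finset.sum_nonneg fun i _ => h0 i ω) (u := fun n : ℕ => ((2 * n : ℕ) : ℝ)) htop ?_
    (L := ∫ ω, W 0 ω ∂P) ?_
  · refine (key.comp tendsto_natCast_atTop_atTop).congr fun n => ?_
    simp
  · have h1 := (tendsto_natCast_div_add_atTop (1 : ℝ)).inv₀ one_ne_zero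
    rw [inv_one] at h1
    refine h1.congr fun n => ?_
    push_cast
    rw [mul_div_mul_left _ _ two_ne_zero, inv_div]
  · have h1 := (he.add ho).div_const 2
    rw [add_self_div_two] at h1
    refine h1.congr fun n => ?_
    simp only [Nat.floor_natCast, hsum]
    push_cast
    rw [← add_div, div_div, mul_comm (n : ℝ) 2]

lemma lintegral_pow_expMeasure {r : ℝ} (hr : 0 < r) (n : ℕ) :
    ∫⁻ u, ENNReal.ofReal (u ^ n) ∂expMeasure r = ENNReal.ofReal (n.factorial / r ^ n) := by
  have := isProbabilityMeasure_expMeasure hr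
  have h1 : ∫⁻ t, erlangDensity r n t = 1 := by
    have := lintegral_epoch hr n (f := fun _ => 1) measurable_const
    simpa using this.symm
  have h2 : ∀ t, exponentialPDF r t * ENNReal.ofReal (t ^ n)
      = ENNReal.ofReal (n.factorial / r ^ n) * erlangDensity r n t := fun t => by
    by_cases ht : 0 ≤ t
    · rw [exponentialPDF_of_nonneg ht, erlangDensity, if_pos ht,
        ← ENNReal.ofReal_mul (by positivity), ← ENNReal.ofReal_mul (by positivity)]
      congr 1
      have : (n.factorial : ℝ) ≠ 0 := by positivity
      field_simp
      ring
    · rw [exponentialPDF_of_neg (not_le.1 ht), erlangDensity, if_neg ht]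
      simp
  rw [lintegral_expMeasure r (by fun_prop)]
  simp_rw [h2]
  rw [lintegral_const_mul _ (measurable_erlangDensity r n), h1, mul_one]

lemma ae_nonneg_expMeasure {r : ℝ} : ∀ᵐ u ∂expMeasure r, 0 ≤ u := by
  have h : expMeasure r = volume.withDensity (exponentialPDF r) := rfl
  rw [h, ae_withDensity_iff (measurable_exponentialPDF r)]
  refine Eventually.of_forall fun u hu => ?_
  by_contra hlt
  exact hu (exponentialPDF_of_neg (not_le.1 hlt))

lemma integrable_pow_expMeasure {r : ℝ} (hr : 0 < r) (n : ℕ) :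
    Integrable (fun u => u ^ n) (expMeasure r) := by
  refine ⟨by fun_prop, ?_⟩
  rw [hasFiniteIntegral_iff_ofReal]
  · rw [lintegral_pow_expMeasure hr]
    exact ENNReal.ofReal_lt_top
  · filter_upwards [ae_nonneg_expMeasure] with u hu using pow_nonneg hu n

lemma integral_pow_expMeasure {r : ℝ} (hr : 0 < r) (n : ℕ) :
    ∫ u, u ^ n ∂expMeasure r = n.factorial / r ^ n := by
  rw [integral_eq_lintegral_of_nonneg_ae _ (by fun_prop), lintegral_pow_expMeasure hr,
    ENNReal.toReal_ofReal (by positivity)]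
  filter_upwards [ae_nonneg_expMeasure] with u hu using pow_nonneg hu n

lemma ae_forall_iidLaw {ρ : Measure ℝ} [IsProbabilityMeasure ρ] {q : ℝ → Prop}
    (h : ∀ᵐ u ∂ρ, q u) : ∀ᵐ x ∂iidLaw ρ, ∀ n, q (x n) :=
  ae_all_iff.2 fun n =>
    (measurePreserving_eval_infinitePi (fun _ : ℕ => ρ) n).quasiMeasurePreserving.ae h

lemma measurable_peakAge (k : ℕ) : Measurable fun p : (ℕ → ℝ) × (ℕ → ℝ) => peakAge p k := by
  unfold peakAge
  fun_prop

section PeakAge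

variable {G H : Measure ℝ} [IsProbabilityMeasure G] [IsProbabilityMeasure H]

lemma integrable_peakAge_sq_and_integral (hG : Integrable (fun x => x ^ 2) G)
    (hH : Integrable (fun x => x ^ 2) H) :
    Integrable (fun p => peakAge p 0 ^ 2) ((iidLaw G).prod (iidLaw H)) ∧
      ∫ p, peakAge p 0 ^ 2 ∂(iidLaw G).prod (iidLaw H)
        = 2 * (∫ x, x ^ 2 ∂G) + (∫ x, x ^ 2 ∂H) + 4 * ((∫ x, x ∂G) * ∫ x, x ∂H)
          + 2 * (∫ x, x ∂G) ^ 2 := by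
  set Q := (iidLaw G).prod (iidLaw H) with hQ
  have hev1 : ∀ i : ℕ, MeasurePreserving (fun p : (ℕ → ℝ) × (ℕ → ℝ) => p.1 i) Q G := fun i =>
    (measurePreserving_eval_infinitePi (fun _ : ℕ => G) i).comp measurePreserving_fst
  have hev2 : ∀ i : ℕ, MeasurePreserving (fun p : (ℕ → ℝ) × (ℕ → ℝ) => p.2 i) Q H := fun i =>
    (measurePreserving_eval_infinitePi (fun _ : ℕ => H) i).comp measurePreserving_snd
  have hi1 : ∀ (φ : ℝ → ℝ), Measurable φ → ∀ i : ℕ, ∫ p, φ (p.1 i) ∂Q = ∫ x, φ x ∂G :=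
    fun φ hφ i => by
      rw [← (hev1 i).map_eq, integral_map (hev1 i).measurable.aemeasurable hφ.aestronglyMeasurable]
  have hi2 : ∀ (φ : ℝ → ℝ), Measurable φ → ∀ i : ℕ, ∫ p, φ (p.2 i) ∂Q = ∫ x, φ x ∂H :=
    fun φ hφ i => by
      rw [← (hev2 i).map_eq, integral_map (hev2 i).measurable.aemeasurable hφ.aestronglyMeasurable]
  have hsq1 : ∀ i : ℕ, Integrable (fun p : (ℕ → ℝ) × (ℕ → ℝ) => p.1 i ^ 2) Q := fun i =>
    (hev1 i).integrable_comp_of_integrable hG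
  have hsq2 : ∀ i : ℕ, Integrable (fun p : (ℕ → ℝ) × (ℕ → ℝ) => p.2 i ^ 2) Q := fun i =>
    (hev2 i).integrable_comp_of_integrable hH
  have hind := iIndepFun_prod_iidLaw G H
  have i12 : IndepFun (fun p : (ℕ → ℝ) × (ℕ → ℝ) => p.1 0) (fun p => p.2 1) Q :=
    hind.indepFun (i := Sum.inl 0) (j := Sum.inr 1) (by simp)
  have i23 : IndepFun (fun p : (ℕ → ℝ) × (ℕ → ℝ) => p.2 1) (fun p => p.1 1) Q :=
    hind.indepFun (i := Sum.inr 1) (j := Sum.inl 1) (by simp)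
  have i13 : IndepFun (fun p : (ℕ → ℝ) × (ℕ → ℝ) => p.1 0) (fun p => p.1 1) Q :=
    hind.indepFun (i := Sum.inl 0) (j := Sum.inl 1) (by simp)
  have m1 : ∀ i : ℕ, MemLp (fun p : (ℕ → ℝ) × (ℕ → ℝ) => p.1 i) 2 Q := fun i =>
    (memLp_two_iff_integrable_sq (by fun_prop)).2 (hsq1 i)
  have m2 : ∀ i : ℕ, MemLp (fun p : (ℕ → ℝ) × (ℕ → ℝ) => p.2 i) 2 Q := fun i =>
    (memLp_two_iff_integrable_sq (by fun_prop)).2 (hsq2 i)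
  have p12 : Integrable (fun p : (ℕ → ℝ) × (ℕ → ℝ) => p.1 0 * p.2 1) Q :=
    (m1 0).integrable_mul (m2 1)
  have p23 : Integrable (fun p : (ℕ → ℝ) × (ℕ → ℝ) => p.2 1 * p.1 1) Q :=
    (m2 1).integrable_mul (m1 1)
  have p13 : Integrable (fun p : (ℕ → ℝ) × (ℕ → ℝ) => p.1 0 * p.1 1) Q :=
    (m1 0).integrable_mul (m1 1)
  have e12 := i12.integral_fun_mul_eq_mul_integral (by fun_prop) (by fun_prop)
  have e23 := i23.integral_fun_mul_eq_mul_integral (by fun_prop) (by fun_prop)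
  have e13 := i13.integral_fun_mul_eq_mul_integral (by fun_prop) (by fun_prop)
  simp only [hi1 (fun x => x) measurable_id, hi2 (fun x => x) measurable_id] at e12 e23 e13
  have hexp : (fun p : (ℕ → ℝ) × (ℕ → ℝ) => peakAge p 0 ^ 2) = fun p =>
      (p.1 0 ^ 2 + p.2 1 ^ 2 + p.1 1 ^ 2)
        + (2 * (p.1 0 * p.2 1) + 2 * (p.2 1 * p.1 1) + 2 * (p.1 0 * p.1 1)) := by
    funext p
    simp only [peakAge]
    ring
  have q1 : Integrable (fun p : (ℕ → ℝ) × (ℕ → ℝ) => p.1 0 ^ 2 + p.2 1 ^ 2) Q :=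
    (hsq1 0).add (hsq2 1)
  have q2 : Integrable (fun p : (ℕ → ℝ) × (ℕ → ℝ) => p.1 0 ^ 2 + p.2 1 ^ 2 + p.1 1 ^ 2) Q :=
    q1.add (hsq1 1)
  have q3 : Integrable (fun p : (ℕ → ℝ) × (ℕ → ℝ) => 2 * (p.1 0 * p.2 1) + 2 * (p.2 1 * p.1 1)) Q :=
    (p12.const_mul 2).add (p23.const_mul 2)
  have q4 : Integrable (fun p : (ℕ → ℝ) × (ℕ → ℝ) =>
      2 * (p.1 0 * p.2 1) + 2 * (p.2 1 * p.1 1) + 2 * (p.1 0 * p.1 1)) Q :=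
    q3.add (p13.const_mul 2)
  rw [hexp]
  refine ⟨q2.add q4, ?_⟩
  rw [integral_add q2 q4, integral_add q1 (hsq1 1), integral_add (hsq1 0) (hsq2 1),
    integral_add q3 (p13.const_mul 2), integral_add (p12.const_mul 2) (p23.const_mul 2),
    integral_const_mul, integral_const_mul, integral_const_mul, e12, e23, e13,
    hi1 (fun x => x ^ 2) (by fun_prop), hi1 (fun x => x ^ 2) (by fun_prop),
    hi2 (fun x => x ^ 2) (by fun_prop)]
  ring

lemma indepFun_peakAge {i j : ℕ} (hij : i + 2 ≤ j) :
    IndepFun (fun p => peakAge p i) (fun p => peakAge p j) ((iidLaw G).prod (iidLaw H)) := by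
  classical
  let S : ℕ → Finset (ℕ ⊕ ℕ) := fun k => {Sum.inl k, Sum.inr (k + 1), Sum.inl (k + 1)}
  have hST : Disjoint (S i) (S j) := by
    simp only [S, Finset.disjoint_left, Finset.mem_insert, Finset.mem_singleton]
    rintro a (rfl | rfl | rfl) <;> simp <;> omega
  have h := (iIndepFun_prod_iidLaw G H).indepFun_finset (S i) (S j) hST fun l =>
    (measurable_pi_apply l).comp measurable_sumElim
  let φ : (k : ℕ) → (S k → ℝ) → ℝ := fun k f =>
    f ⟨Sum.inl k, by simp [S]⟩ + f ⟨Sum.inr (k + 1), by simp [S]⟩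
      + f ⟨Sum.inl (k + 1), by simp [S]⟩
  have hφ : ∀ k, Measurable (φ k) := fun k => by simp only [φ]; fun_prop
  exact h.comp (hφ i) (hφ j)

lemma ae_tendsto_average_peakAge_sq (hG : Integrable (fun x => x ^ 2) G)
    (hH : Integrable (fun x => x ^ 2) H) :
    ∀ᵐ p ∂(iidLaw G).prod (iidLaw H),
      Tendsto (fun n : ℕ => (∑ i ∈ Finset.range n, peakAge p i ^ 2) / n) atTop
        (𝓝 (2 * (∫ x, x ^ 2 ∂G) + (∫ x, x ^ 2 ∂H) + 4 * ((∫ x, x ∂G) * ∫ x, x ∂H)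
          + 2 * (∫ x, x ∂G) ^ 2)) := by
  obtain ⟨h1, h2⟩ := integrable_peakAge_sq_and_integral hG hH
  rw [← h2]
  refine ae_tendsto_average_of_indep_apart (W := fun i p => peakAge p i ^ 2)
    (fun _ _ => sq_nonneg _) h1 (fun i => ?_) fun i j hij => ?_
  · refine ⟨((measurable_peakAge i).pow_const 2).aemeasurable,
      ((measurable_peakAge 0).pow_const 2).aemeasurable, ?_⟩
    have hshift := (measurePreserving_dropSeq G i).prod (measurePreserving_dropSeq H i)
    conv_rhs => rw [← hshift.map_eq]
    rw [Measure.map_map ((measurable_peakAge 0).pow_const 2) hshift.measurable]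
    rfl
  · exact (indepFun_peakAge hij).comp (φ := fun x => x ^ 2) (ψ := fun x => x ^ 2)
      (by fun_prop) (by fun_prop)

end PeakAge

/-! ### The average age upon decisions -/

lemma departureTime_eq_completionTime {s x : ℕ → ℝ} (hx : Tendsto (epoch x) atTop atTop) (k : ℕ) :
    departureTime (epoch x) s k = completionTime (s, gap s x) k := by
  rw [departureTime, arrivalTime_eq_sum hx, completionTime, epoch, Finset.sum_add_distrib,
    Finset.sum_range_succ s, add_assoc]

lemma setOf_le_eq_Iio {u : ℕ → ℝ} (hmono : Monotone u) (htop : Tendsto u atTop atTop) (t : ℝ) :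
    ∃ N, {j | u j ≤ t} = Set.Iio N := by
  classical
  have hex : ∃ n, t < u n := (htop.eventually_gt_atTop t).exists
  refine ⟨Nat.find hex, Set.ext fun j => ⟨fun hj => ?_, fun hj => not_lt.1 (Nat.find_min hex hj)⟩⟩
  by_contra hlt
  exact ((Nat.find_spec hex).trans_le (hmono (not_lt.1 hlt))).not_ge hj

/-- After the first completion, the age in the queue is given by `cycleAge`. -/
lemma ageUponDecision_eq_toReal_cycleAge {s x : ℕ → ℝ} (hx : Tendsto (epoch x) atTop atTop)
    (hs : ∀ k, 0 ≤ s k) (hj : ∀ k, 0 ≤ gap s x k)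
    (hd : Tendsto (completionTime (s, gap s x)) atTop atTop) (u : ℝ) {t : ℝ}
    (ht : completionTime (s, gap s x) 0 ≤ t) :
    ageUponDecision u (epoch x) s t = (cycleAge (s, gap s x) t).toReal := by
  set p := (s, gap s x) with hp
  have hmono : Monotone (completionTime p) := monotone_completionTime hs hj
  obtain ⟨N, hN⟩ := setOf_le_eq_Iio hmono hd t
  have h0 : 0 ∈ Set.Iio N := hN ▸ ht
  obtain ⟨k, rfl⟩ : ∃ k, N = k + 1 := Nat.exists_eq_add_one.2 h0
  have hk : completionTime p k ≤ t := by
    have : k ∈ {j | completionTime p j ≤ t} := hN ▸ k.lt_succ_self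
    exact this
  have hk1 : t < completionTime p (k + 1) := by
    by_contra hlt
    have : k + 1 ∈ Set.Iio (k + 1) := hN ▸ not_lt.1 hlt
    exact lt_irrefl (k + 1) this
  have hset : {j | departureTime (epoch x) s j ≤ t} = Set.Iic k := by
    simp_rw [departureTime_eq_completionTime hx]
    rw [hN]
    ext j
    simp
  have hex : ∃ j, departureTime (epoch x) s j ≤ t := ⟨k, by
    rwa [departureTime_eq_completionTime hx]⟩
  have harr : arrivalTime (epoch x) s k = completionTime p k - s k := by
    rw [← departureTime_eq_completionTime hx, departureTime, add_sub_cancel_right]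
  rw [ageUponDecision, generationTime, if_pos hex, hset, csSup_Iic, harr,
    cycleAge_of_mem (p := p) hs hj ⟨hk, hk1⟩, ENNReal.toReal_ofReal]
  · simp only [hp]; ring
  · exact add_nonneg (sub_nonneg.2 hk) (hs k)

lemma eventSum_eq_sum {f : ℝ → ℝ≥0∞} {z : ℕ → ℝ} {T : ℝ} {N : ℕ}
    (hN : {j | epoch z j ≤ T} = Set.Iio N) :
    eventSum f z T = ∑ j ∈ Finset.range N, f (epoch z j) := by
  have hiff : ∀ j, epoch z j ≤ T ↔ j < N := fun j => Set.ext_iff.1 hN j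
  rw [eventSum, tsum_eq_sum (s := Finset.range N)]
  · exact Finset.sum_congr rfl fun j hj =>
      Set.indicator_of_mem (show epoch z j ∈ Set.Iic T from (hiff j).2 (Finset.mem_range.1 hj)) _
  · exact fun j hj => Set.indicator_of_notMem
      (show epoch z j ∉ Set.Iic T from fun h => hj (Finset.mem_range.2 ((hiff j).1 h))) _

/-- If `Δ` agrees with `f` from some time on, the average of `Δ` over the events is the ratio of the
average rates of the sums of `f` and of `1` over the events. -/
lemma hasAverageAge_of_eventSum {z : ℕ → ℝ} (hz : ∀ j, 0 ≤ z j)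
    (hzt : Tendsto (epoch z) atTop atTop) {f : ℝ → ℝ≥0∞} {Δ : ℝ → ℝ} {b r v : ℝ} (hr : 0 < r)
    (hΔ : ∀ t, b ≤ t → Δ t = (f t).toReal) (hfin : ∀ T, eventSum f z T ≠ ∞)
    (hf : Tendsto (fun T => (eventSum f z T).toReal / T) atTop (𝓝 (r * v)))
    (h1 : Tendsto (fun T => (eventSum (fun _ => 1) z T).toReal / T) atTop (𝓝 r)) :
    HasAverageAge (epoch z) Δ v := by
  refine ⟨hzt, ?_⟩
  have hmono : Monotone (epoch z) := monotone_nat_of_le_succ fun n => by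
    rw [epoch_succ]
    linarith [hz (n + 1)]
  have hcount : ∀ T, {j | epoch z j ≤ T} = Set.Iio (decisionCount (epoch z) T) := fun T => by
    obtain ⟨N, hN⟩ := setOf_le_eq_Iio hmono hzt T
    rw [decisionCount, hN]
    congr 1
    rw [← Finset.coe_range, Set.ncard_coe_finset, Finset.card_range]
  set N := decisionCount (epoch z) with hNdef
  have hN1 : ∀ T, (eventSum (fun _ => 1) z T).toReal = N T := fun T => by
    rw [eventSum_eq_sum (hcount T)]; simp
  have hf1 : ∀ T, (eventSum f z T).toReal
      = ∑ j ∈ Finset.range (N T), (f (epoch z j)).toReal := fun T => by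
    have h := hfin T
    rw [eventSum_eq_sum (hcount T)] at h ⊢
    exact ENNReal.toReal_sum fun j hj => ne_top_of_le_ne_top h
      (Finset.single_le_sum (f := fun j => f (epoch z j)) (fun _ _ => zero_le) hj)
  simp_rw [hN1] at h1
  have hNtop : Tendsto (fun T => (N T : ℝ)) atTop atTop := by
    refine (h1.pos_mul_atTop hr tendsto_id).congr' ?_
    filter_upwards [eventually_gt_atTop 0] with T hT
    simp only [id_eq]
    field_simp
  obtain ⟨J, hJ⟩ := eventually_atTop.1 (hzt.eventually_ge_atTop b)
  -- Only the finitely many events before time `b` contribute to the error `e`.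
  set e : ℕ → ℝ := fun j => Δ (epoch z j) - (f (epoch z j)).toReal with he
  have he0 : ∀ j ≥ J, e j = 0 := fun j hj => sub_eq_zero.2 (hΔ _ (hJ j hj))
  have herr : Tendsto (fun T => (∑ j ∈ Finset.range (N T), e j) / N T) atTop (𝓝 0) := by
    refine (tendsto_const_nhds (x := ∑ j ∈ Finset.range J, e j)).div_atTop hNtop |>.congr' ?_
    filter_upwards [hNtop.eventually_ge_atTop (J : ℝ)] with T hT
    rw [Finset.eventually_constant_sum he0 (Nat.cast_le.1 hT)]
  have hmain := (hf.div h1 hr.ne').add herr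
  rw [mul_div_cancel_left₀ _ hr.ne', add_zero] at hmain
  refine hmain.congr' ?_
  filter_upwards [eventually_gt_atTop 0, hNtop.eventually_gt_atTop 0] with T hT hNT
  simp only [Pi.div_apply, hf1, he, Finset.sum_sub_distrib]
  field_simp
  ring

/-- The joint law of the service times, the inter-arrival times and the inter-decision times. -/
lemma IsMG11M.map_eq {Ω : Type*} [MeasurableSpace Ω] {P : Measure Ω} [IsProbabilityMeasure P]
    {lam nu : ℝ} (hlam : 0 < lam) (hnu : 0 < nu) {G : Measure ℝ} [IsProbabilityMeasure G]
    {X S Z : ℕ → Ω → ℝ} (h : IsMG11M P lam nu G X S Z) :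
    AEMeasurable (fun ω => ((fun k => S k ω, fun n => X n ω), fun j => Z j ω)) P ∧
      P.map (fun ω => ((fun k => S k ω, fun n => X n ω), fun j => Z j ω))
        = ((iidLaw G).prod (iidLaw (expMeasure lam))).prod (iidLaw (expMeasure nu)) := by
  have := isProbabilityMeasure_expMeasure hlam
  have := isProbabilityMeasure_expMeasure hnu
  let e : (ℕ ⊕ ℕ) ⊕ ℕ → ℕ ⊕ ℕ ⊕ ℕ :=
    Sum.elim (Sum.elim (fun k => Sum.inr (Sum.inl k)) Sum.inl) fun j => Sum.inr (Sum.inr j)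
  have he : Function.Injective e := by
    rintro ((i | i) | i) ((j | j) | j) hij <;> simp_all [e]
  let α : ℕ ⊕ ℕ → Measure ℝ := Sum.elim (fun _ => G) fun _ => expMeasure lam
  let γ : (ℕ ⊕ ℕ) ⊕ ℕ → Measure ℝ := Sum.elim α fun _ => expMeasure nu
  have hα : ∀ i, IsProbabilityMeasure (α i) := by
    rintro (i | i)
    exacts [inferInstanceAs (IsProbabilityMeasure G),
      inferInstanceAs (IsProbabilityMeasure (expMeasure lam))]
  have hγ : ∀ i, IsProbabilityMeasure (γ i) := by
    rintro (i | i)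
    exacts [hα i, inferInstanceAs (IsProbabilityMeasure (expMeasure nu))]
  let Y : (ℕ ⊕ ℕ) ⊕ ℕ → Ω → ℝ := fun i => Sum.elim X (Sum.elim S Z) (e i)
  have hY : ∀ i, HasLaw (Y i) (γ i) P := by
    rintro ((i | i) | i)
    exacts [h.law_service i, h.law_interarrival i, h.law_decision i]
  have hlaw := (h.indep.precomp he).hasLaw_infinitePi hY
    (aemeasurable_pi_iff.2 fun i => (hY i).aemeasurable)
  have hsplit1 : MeasurePreserving
      (fun f : (ℕ ⊕ ℕ) ⊕ ℕ → ℝ => (fun i => f (Sum.inl i), fun i => f (Sum.inr i)))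
      (Measure.infinitePi γ) ((Measure.infinitePi α).prod (iidLaw (expMeasure nu))) :=
    ⟨by fun_prop, map_infinitePi_sum γ⟩
  have hsplit2 : MeasurePreserving
      (fun f : ℕ ⊕ ℕ → ℝ => (fun i => f (Sum.inl i), fun i => f (Sum.inr i)))
      (Measure.infinitePi α) ((iidLaw G).prod (iidLaw (expMeasure lam))) :=
    ⟨by fun_prop, map_infinitePi_sum α⟩
  have hsplit := (hsplit2.prod (MeasurePreserving.id (iidLaw (expMeasure nu)))).comp hsplit1
  refine ⟨hsplit.measurable.comp_aemeasurable hlaw.aemeasurable, ?_⟩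
  rw [← hsplit.map_eq, ← hlaw.map_eq,
    AEMeasurable.map_map_of_aemeasurable hsplit.measurable.aemeasurable hlaw.aemeasurable]
  rfl

/-- Passing from the inter-arrival times of all updates to the idle periods of the server does not
change the law of the system. -/
lemma measurePreserving_gap {r : ℝ} (hr : 0 < r) {G : Measure ℝ} [IsProbabilityMeasure G]
    (hG : ∀ᵐ x ∂G, 0 ≤ x) :
    MeasurePreserving (fun p : (ℕ → ℝ) × (ℕ → ℝ) => (p.1, gap p.1 p.2))
      ((iidLaw G).prod (iidLaw (expMeasure r))) ((iidLaw G).prod (iidLaw (expMeasure r))) := by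
  have := isProbabilityMeasure_expMeasure hr
  refine (MeasurePreserving.id (iidLaw G)).skew_product (g := gap) measurable_gap ?_
  filter_upwards [ae_forall_iidLaw hG] with s hs using map_gap hr hs

lemma lintegral_one_Icc (T : ℝ) : ∫⁻ _ in Set.Icc 0 T, (1 : ℝ≥0∞) = ENNReal.ofReal T := by
  rw [setLIntegral_one, Real.volume_Icc, sub_zero]

/-- The number of decisions up to time `T` grows like `r T`. -/
lemma ae_tendsto_eventSum_one_div {E : Type*} [MeasurableSpace E] (Q : Measure E)
    [IsProbabilityMeasure Q] {r : ℝ} (hr : 0 < r) :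
    ∀ᵐ p ∂Q.prod (iidLaw (expMeasure r)),
      Tendsto (fun T => (eventSum (fun _ => 1) p.2 T).toReal / T) atTop (𝓝 r) := by
  have h := ae_tendsto_eventSum_div (Q := Q) hr (F := fun _ _ => 1) (v := 1) measurable_const
    (Eventually.of_forall fun _ T => by rw [lintegral_one_Icc]; exact ENNReal.ofReal_ne_top)
    (Eventually.of_forall fun _ => ?_) (Eventually.of_forall fun _ => ⟨1, ENNReal.one_ne_top,
      fun n => ?_⟩)
  · filter_upwards [h] with p hp
    simpa using hp.2
  · refine tendsto_const_nhds.congr' ?_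
    filter_upwards [eventually_gt_atTop 0] with T hT
    rw [lintegral_one_Icc, ENNReal.toReal_ofReal hT.le, div_self hT.ne']
  · simp only [one_pow, one_mul]
    rw [lintegral_one_Icc]
    refine ENNReal.ofReal_le_ofReal (pow_le_pow_right₀ ?_ (by norm_num))
    linarith [n.cast_nonneg (α := ℝ)]

end UpdateDecision

end

open UpdateDecision in
theorem theorem1 {Ω : Type*} [MeasurableSpace Ω] (P : Measure Ω) [IsProbabilityMeasure P]
    (lam mu nu : ℝ) (hlam : 0 < lam) (hmu : 0 < mu) (hnu : 0 < nu)
    (G : Measure ℝ) [IsProbabilityMeasure G]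
    (hG_nonneg : ∀ᵐ x ∂G, 0 ≤ x)
    (hG_mean : ∫ x, x ∂G = 1 / mu)
    (hG_sq : Integrable (fun x : ℝ => x ^ 2) G)
    (X S Z : ℕ → Ω → ℝ)
    (hsys : UpdateDecision.IsMG11M P lam nu G X S Z)
    (u₀ : Ω → ℝ) :
    ∀ᵐ ω ∂P,
      UpdateDecision.HasAverageAge
        (UpdateDecision.epoch (fun j => Z j ω))
        (UpdateDecision.ageUponDecision (u₀ ω)
          (UpdateDecision.epoch (fun n => X n ω)) (fun k => S k ω))
        (lam * mu * (∫ x, x ^ 2 ∂G) / (2 * (lam + mu)) + (lam + mu) / (lam * mu)) := by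
  have := isProbabilityMeasure_expMeasure hlam
  have := isProbabilityMeasure_expMeasure hnu
  set H := expMeasure lam with hH
  set Q := (iidLaw G).prod (iidLaw H) with hQ
  have hG1 : Integrable (fun x : ℝ => x) G :=
    ((memLp_two_iff_integrable_sq (by fun_prop)).2 hG_sq).integrable one_le_two
  have hH1 : ∫ x, x ∂H = 1 / lam := by simpa using integral_pow_expMeasure hlam 1
  have hH2 : ∫ x, x ^ 2 ∂H = 2 / lam ^ 2 := by simpa using integral_pow_expMeasure hlam 2
  have hHi1 : Integrable (fun x : ℝ => x) H := by simpa using integrable_pow_expMeasure hlam 1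
  have hHi2 : Integrable (fun x : ℝ => x ^ 2) H := integrable_pow_expMeasure hlam 2
  set v := lam * mu * (∫ x, x ^ 2 ∂G) / (2 * (lam + mu)) + (lam + mu) / (lam * mu) with hv
  -- Almost sure properties of the service times `p.1` and the idle periods `p.2`.
  have hfst : ∀ᵐ s ∂iidLaw G, (∀ k, 0 ≤ s k) ∧
      Tendsto (fun n : ℕ => (∑ i ∈ Finset.range n, s i) / (n : ℝ)) atTop (𝓝 (1 / mu)) ∧
      Tendsto (fun n : ℕ => (∑ i ∈ Finset.range n, s i ^ 2) / (n : ℝ)) atTop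
        (𝓝 (∫ x, x ^ 2 ∂G)) := by
    rw [← hG_mean]
    filter_upwards [ae_forall_iidLaw hG_nonneg, ae_tendsto_average_iidLaw G measurable_id hG1,
      ae_tendsto_average_iidLaw G (φ := fun x => x ^ 2) (by fun_prop) hG_sq] with s h1 h2 h3
    exact ⟨h1, h2, h3⟩
  have hsnd : ∀ᵐ j ∂iidLaw H, (∀ k, 0 ≤ j k) ∧
      Tendsto (fun n : ℕ => (∑ i ∈ Finset.range n, j i) / (n : ℝ)) atTop (𝓝 (1 / lam)) := by
    rw [← hH1]
    filter_upwards [ae_forall_iidLaw (ae_nonneg_expMeasure (r := lam)),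
      ae_tendsto_average_iidLaw H measurable_id hHi1] with s h1 h2
    exact ⟨h1, h2⟩
  have hy : 0 < 1 / mu + 1 / lam := by positivity
  have hpeak := ae_tendsto_average_peakAge_sq hG_sq hHi2
  have hpath : ∀ᵐ p ∂Q, (∀ k, 0 ≤ p.1 k) ∧ (∀ k, 0 ≤ p.2 k) ∧
      Tendsto (completionTime p) atTop atTop ∧
      (∀ T, ∫⁻ t in Set.Icc 0 T, cycleAge p t ≠ ∞) ∧
      Tendsto (fun T => (∫⁻ t in Set.Icc 0 T, cycleAge p t).toReal / T) atTop (𝓝 v) ∧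
      ∃ K : ℝ≥0∞, K ≠ ∞ ∧ ∀ n : ℕ, ∫⁻ t in Set.Icc 0 (((n : ℝ) + 1) ^ 4), cycleAge p t ^ 2
        ≤ K * ENNReal.ofReal (((n : ℝ) + 1) ^ 6) := by
    filter_upwards [Measure.quasiMeasurePreserving_fst.ae hfst,
      Measure.quasiMeasurePreserving_snd.ae hsnd, hpeak] with p ⟨hs, hs1, hs2⟩ ⟨hj, hj1⟩ hp
    have hd := tendsto_completionTime_div hs1 hj1
    have htop := tendsto_completionTime hy hd
    refine ⟨hs, hj, htop, lintegral_cycleAge_ne_top hs hj htop, ?_,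
      exists_lintegral_cycleAge_sq_le hs hj hy hd hs2 hp⟩
    convert tendsto_lintegral_cycleAge_div hs hj hy hd hs2 hp using 2
    rw [hv, hG_mean, hH1, hH2]
    field_simp
    ring
  have hsample := ae_tendsto_eventSum_div (Q := Q) hnu measurable_cycleAge
    (hpath.mono fun p hp => hp.2.2.2.1) (hpath.mono fun p hp => hp.2.2.2.2.1)
    (hpath.mono fun p hp => hp.2.2.2.2.2)
  have hgood : ∀ᵐ q ∂Q.prod (iidLaw (expMeasure nu)), ((∀ k, 0 ≤ q.1.1 k) ∧ (∀ k, 0 ≤ q.1.2 k) ∧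
      Tendsto (completionTime q.1) atTop atTop) ∧
      ((∀ T, eventSum (cycleAge q.1) q.2 T ≠ ∞) ∧
        Tendsto (fun T => (eventSum (cycleAge q.1) q.2 T).toReal / T) atTop (𝓝 (nu * v))) ∧
      Tendsto (fun T => (eventSum (fun _ => 1) q.2 T).toReal / T) atTop (𝓝 nu) := by
    filter_upwards [Measure.quasiMeasurePreserving_fst.ae hpath, hsample,
      ae_tendsto_eventSum_one_div Q hnu] with q h1 h2 h3
    exact ⟨⟨h1.1, h1.2.1, h1.2.2.1⟩, h2, h3⟩
  -- The idle periods are now expressed through the inter-arrival times.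
  have hgap := ((measurePreserving_gap hlam hG_nonneg).prod
    (MeasurePreserving.id (iidLaw (expMeasure nu)))).quasiMeasurePreserving.ae hgood
  have hz : ∀ᵐ z ∂iidLaw (expMeasure nu), (∀ j, 0 ≤ z j) ∧ Tendsto (epoch z) atTop atTop :=
    (ae_forall_iidLaw ae_nonneg_expMeasure).and (ae_tendsto_epoch hnu)
  replace hz := (Measure.quasiMeasurePreserving_snd (μ := Q)).ae hz
  have hx : ∀ᵐ q ∂Q.prod (iidLaw (expMeasure nu)), Tendsto (epoch q.1.2) atTop atTop :=
    Measure.quasiMeasurePreserving_fst.ae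
      (Measure.quasiMeasurePreserving_snd.ae (ae_tendsto_epoch hlam))
  obtain ⟨hmeas, hmap⟩ := hsys.map_eq hlam hnu
  rw [← hmap] at hgap hz hx
  filter_upwards [ae_of_ae_map hmeas hgap, ae_of_ae_map hmeas hz, ae_of_ae_map hmeas hx]
    with ω ⟨⟨hs, hj, hd⟩, ⟨hfin, hf⟩, hcount⟩ ⟨hz0, hzt⟩ hxt
  exact hasAverageAge_of_eventSum hz0 hzt hnu
    (fun t ht => ageUponDecision_eq_toReal_cycleAge hxt hs hj hd (u₀ ω) ht) hfin hf hcount
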